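/- Model. Let $\lambda>0$, $\alpha>2$, $T>0$, $\sigma^2\ge 0$, $0<\delta\le 1$. The base stations (BSs) form a homogeneous Poisson point process $\Phi=\{x_0,x_1,\dots\}$ of density $\lambda$ in $\mathbb R^2$; the BSs have i.i.d. fading coefficients $h_n\sim\mathcal{CN}(0,1)$, independent of $\Phi$. For a user at $u\in\mathbb R^2$ let $x_k$ be its nearest BS. If all BSs in a region $C\subseteq\mathbb R^2$ cooperate (so that they do not interfere with each other), the user is covered if $$\mathrm{SINR}=\frac{|h_k|^2\|x_k-u\|^{-\alpha}}{\sigma^2+\sum_{n\ne k,\;x_n\notin C}|h_n|^2\|x_n-u\|^{-\alpha}}\ \ge\ T .$$ Let $P_{c,R}(T)$ be the coverage probability of a user at $u=((1-\delta)R,0)$ when the cooperating cluster is the disc $C=B(o,R)$, and let $P_{c,\infty}(T)$ be the coverage probability when $C=\mathbb R^2$ (ideal cloud: no interference; by stationarity the user's position is irrelevant). Let $$R^*(\epsilon,\delta)=\min\{R>0:\ P_{c,R}(T)=(1-\epsilon)P_{c,\infty}(T)\}.$$ Statement. For all sufficiently small $\epsilon>0$ the minimum $R^*(\epsilon,\delta)$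 exists, and $$R^*(\epsilon,\delta)\sim\bigl(\lambda\,T\,\Delta(\delta)\,\eta(T)\,\epsilon^{-1}\bigr)^{1/(\alpha-2)},\qquad \epsilon\to0^+,$$ where $\sim$ means that the ratio of the two sides tends to $1$, $$\Delta(\delta)=\int_{B(o,1)^c}\|z-(1-\delta,0)\|^{-\alpha}\,dz,\qquad \eta(T)=\frac{\mathbb E[\exp(-T\sigma^2r^\alpha)\,r^\alpha]}{\mathbb E[\exp(-T\sigma^2r^\alpha)]},$$ and $r$ is the distance from the origin to the nearest point of $\Phi$. If moreover $\sigma^2=0$, then $\eta(T)=\pi^{-\alpha/2}\lambda^{-\alpha/2}\Gamma(\tfrac{\alpha}{2}+1)$, and the mean number of BSs in the cluster satisfies $$\mathbb E[\Phi(B(o,R^*(\epsilon,\delta)))]=\lambda\pi R^*(\epsilon,\delta)^2\sim\Bigl(T\,\Delta(\delta)\,\pi^{-1}\,\Gamma(\tfrac{\alpha}{2}+1)\,\epsilon^{-1}\Bigr)^{2/(\alpha-2)},\qquad \epsilon\to0^+.$$ -/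

import Mathlib

open MeasureTheory ProbabilityTheory Filter Topology Asymptotics
open scoped ENNReal NNReal

noncomputable section

namespace CloudRadio

/-- The plane `ℝ²` with its Euclidean norm. -/
abbrev Plane : Type := EuclideanSpace ℝ (Fin 2)

/-- The circularly symmetric complex Gaussian law `CN(0,1)`: real and imaginary parts are
independent centred real Gaussians of variance `1/2`. -/
def stdComplexGaussian : Measure ℂ :=
  ((gaussianReal 0 (1 / 2)).prod (gaussianReal 0 (1 / 2))).map
    (fun p : ℝ × ℝ => (⟨p.1, p.2⟩ : ℂ))

/-- The number `Φ(A)` of points of the configuration `Φ = {x 0, x 1, …}` that lie in `A`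
(counted with multiplicity, possibly infinite). -/
def count (x : ℕ → Plane) (A : Set Plane) : ℕ∞ := {n | x n ∈ A}.encard

/-- The random points `X 0, X 1, …` are a measurable enumeration of a homogeneous Poisson point
process on the plane with intensity (density) `lam`: the number of points in a measurable set `A`
of finite area `|A|` has the Poisson law of mean `lam * |A|`, and the numbers of points in
finitely many pairwise disjoint measurable sets are independent. -/
structure IsPoissonProcess {Ω : Type*} [MeasurableSpace Ω] (P : Measure Ω)
    (lam : ℝ) (X : ℕ → Ω → Plane) : Prop where
  measurable : ∀ n, Measurable (X n)
  count_law : ∀ A : Set Plane, MeasurableSet A → volume A < ∞ →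
    HasLaw (fun ω => count (fun n => X n ω) A)
      ((poissonMeasure (ENNReal.ofReal lam * volume A).toNNReal).map (Nat.cast : ℕ → ℕ∞)) P
  count_indep : ∀ (m : ℕ) (A : Fin m → Set Plane), (∀ i, MeasurableSet (A i)) →
    Pairwise (fun i j => Disjoint (A i) (A j)) →
    iIndepFun (fun i ω => count (fun n => X n ω) (A i)) P

/-- Power `|g|² ‖x - u‖^{-α}` received at `u` from a base station at `x` with fading `g`. -/
def rxPower (α : ℝ) (u x : Plane) (g : ℂ) : ℝ≥0∞ := ‖g‖ₑ ^ 2 * edist x u ^ (-α)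

/-- Interference at a user at `u` served by the `k`-th base station, when all base stations in
the region `C` cooperate: the power received from all the other base stations outside `C`. -/
def interference (α : ℝ) (u : Plane) (C : Set Plane) (x : ℕ → Plane) (g : ℕ → ℂ) (k : ℕ) :
    ℝ≥0∞ :=
  ∑' n, Set.indicator {n | n ≠ k ∧ x n ∉ C} (fun n => rxPower α u (x n) (g n)) n

/-- Signal to interference-plus-noise ratio at `u`, with serving base station `k`, noise variance
`σ ^ 2` and cooperation region `C`. -/
def sinr (α σ : ℝ) (u : Plane) (C : Set Plane) (x : ℕ → Plane) (g : ℕ → ℂ) (k : ℕ) : ℝ≥0∞ :=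
  rxPower α u (x k) (g k) / (ENNReal.ofReal (σ ^ 2) + interference α u C x g k)

/-- Station `k` is the serving station of a user at `u`: it is strictly closer than all others. -/
def IsNearest (u : Plane) (x : ℕ → Plane) (k : ℕ) : Prop :=
  ∀ n, n ≠ k → dist (x k) u < dist (x n) u

/-- Probability that a user at `u` is covered, i.e. that the SINR from its nearest base station is
at least `T`, when the base stations in the region `C` cooperate. -/
def coverage {Ω : Type*} [MeasurableSpace Ω] (P : Measure Ω) (α σ T : ℝ)
    (X : ℕ → Ω → Plane) (h : ℕ → Ω → ℂ) (C : Set Plane) (u : Plane) : ℝ :=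
  P.real {ω | ∃ k, IsNearest u (fun n => X n ω) k ∧
    ENNReal.ofReal T ≤ sinr α σ u C (fun n => X n ω) (fun n => h n ω) k}

/-- `P_{c,R}(T)`: the cluster is the disc `B(o,R)`, the user is at `((1 - δ) R, 0)`. -/
def clusterCoverage {Ω : Type*} [MeasurableSpace Ω] (P : Measure Ω) (α σ T : ℝ)
    (X : ℕ → Ω → Plane) (h : ℕ → Ω → ℂ) (δ R : ℝ) : ℝ :=
  coverage P α σ T X h (Metric.ball 0 R) !₂[(1 - δ) * R, 0]

/-- `P_{c,∞}(T)`: the whole network cooperates, so there is no interference. By stationarity the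
position of the user is irrelevant; it is placed at the origin. -/
def idealCoverage {Ω : Type*} [MeasurableSpace Ω] (P : Measure Ω) (α σ T : ℝ)
    (X : ℕ → Ω → Plane) (h : ℕ → Ω → ℂ) : ℝ :=
  coverage P α σ T X h Set.univ 0

/-- The cluster radii `R` with `P_{c,R}(T) = (1 - ε) P_{c,∞}(T)`. -/
def admissibleRadii {Ω : Type*} [MeasurableSpace Ω] (P : Measure Ω) (α σ T : ℝ)
    (X : ℕ → Ω → Plane) (h : ℕ → Ω → ℂ) (δ ε : ℝ) : Set ℝ :=
  {R | 0 < R ∧ clusterCoverage P α σ T X h δ R = (1 - ε) * idealCoverage P α σ T X h}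

/-- `R^*(ε,δ)`, the smallest admissible cluster radius. -/
def optRadius {Ω : Type*} [MeasurableSpace Ω] (P : Measure Ω) (α σ T : ℝ)
    (X : ℕ → Ω → Plane) (h : ℕ → Ω → ℂ) (δ ε : ℝ) : ℝ :=
  sInf (admissibleRadii P α σ T X h δ ε)

/-- Distance `r` from the origin (a typical user) to its nearest base station. -/
def nearestDist {Ω : Type*} (X : ℕ → Ω → Plane) (ω : Ω) : ℝ := ⨅ n, dist (X n ω) 0

/-- `η(T) = E[exp(-T σ² r^α) r^α] / E[exp(-T σ² r^α)]`. -/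
def eta {Ω : Type*} [MeasurableSpace Ω] (P : Measure Ω) (α σ T : ℝ) (X : ℕ → Ω → Plane) : ℝ :=
  (∫ ω, Real.exp (-T * σ ^ 2 * nearestDist X ω ^ α) * nearestDist X ω ^ α ∂P) /
    ∫ ω, Real.exp (-T * σ ^ 2 * nearestDist X ω ^ α) ∂P

/-- `Δ(δ) = ∫_{B(o,1)^c} ‖z - (1 - δ, 0)‖^{-α} dz`. -/
def Delta (α δ : ℝ) : ℝ :=
  ∫ z in (Metric.ball (0 : Plane) 1)ᶜ, ‖z - !₂[1 - δ, 0]‖ ^ (-α)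

/-- Mean number `E[Φ(B(o,R))]` of base stations in a cluster of radius `R`. -/
def meanClusterSize {Ω : Type*} [MeasurableSpace Ω] (P : Measure Ω) (X : ℕ → Ω → Plane)
    (R : ℝ) : ℝ≥0∞ :=
  ∫⁻ ω, (count (fun n => X n ω) (Metric.ball 0 R) : ℝ≥0∞) ∂P

end CloudRadio

end

noncomputable section

namespace CloudRadio

/-! ### The Laplace functional of a Poisson process and Campbell's formula. -/

section

/-! Since `|h|²` is exponential of mean 1, fixing the stations and averaging over the fading gives
coverage probability `exp(-T σ² r^α) ∏ 1/(1 + w_n)`. Here `r` is the distance to the nearest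
station, and `w_n = T (r/‖x_n - u‖)^α` runs over the interferers. Written as `exp(-∑ log(1 + w_n))`,
the product is the kind of functional that the Laplace functional of a Poisson process averages.
Given `r`, the stations beyond distance `r` are still Poisson, so coverage equals `E[exp(-T σ² r^α)
exp(-λ ∫ w/(1 + w) dz)]`, with the integral over points outside `C` and farther than `r` from `u`.
The law of `r` does not depend on `u` (`coverage_eq_toReal_lintegral_nearestDist`). The conditioning
on `r` uses no Palm calculus: `r` is confined to small intervals, each such event is a difference of
two void events, and the mesh tends to 0 (`IsPoissonProcess.lintegral_expNeg_extField`).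

For the disc of radius `R`, rescaling turns the integral into `R² M(r/R)` with `M = exteriorMass`.
One has `M(q) ≤ T Δ q^α`, and `q^(-α) M(q) → T Δ` as `q → 0`. Since `r^α` has finite mean, dominated
convergence shows that the coverage loss times `R^(α-2)` tends to `λ T Δ E[exp(-T σ² r^α) r^α]`
(`tendsto_rpow_mul_coverage_loss`). Divided by the ideal coverage, the constant is `λ T Δ η`.

The relative loss `D(R)` is continuous, and it is nonincreasing because the discs, seen from their
users, are nested. What remains is deterministic: a continuous nonincreasing `D` with `R^β D(R) → c
> 0` attains every small level `ε`, first at a radius equivalent to `(c/ε)^(1/β)`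
(`isLeast_and_isEquivalent_sInf_of_tendsto_rpow_mul`).

Working in `[0, ∞]` with `expNeg ∞ = 0` avoids summability conditions and lets an infinite weight
encode a void event. -/

/-- The function `t ↦ exp (-t)` on `[0, ∞]`. -/
def expNeg (t : ℝ≥0∞) : ℝ≥0∞ := EReal.exp (-(t : EReal))

lemma expNeg_zero : expNeg 0 = 1 := by simp [expNeg]

lemma expNeg_top : expNeg ∞ = 0 := by simp [expNeg]

lemma expNeg_add (s t : ℝ≥0∞) : expNeg (s + t) = expNeg s * expNeg t := by
  rw [expNeg, expNeg, expNeg, ← EReal.exp_add, EReal.coe_ennreal_add, EReal.neg_add, sub_eq_add_neg]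
  · left; simp
  · right; simp

lemma expNeg_le_one (t : ℝ≥0∞) : expNeg t ≤ 1 := by
  simpa [expNeg] using EReal.coe_ennreal_nonneg t

lemma expNeg_ne_top (t : ℝ≥0∞) : expNeg t ≠ ∞ :=
  ne_top_of_le_ne_top ENNReal.one_ne_top (expNeg_le_one t)

lemma expNeg_antitone : Antitone expNeg := fun s t hst => by
  simpa [expNeg] using hst

lemma expNeg_ofReal {x : ℝ} (hx : 0 ≤ x) :
    expNeg (ENNReal.ofReal x) = ENNReal.ofReal (Real.exp (-x)) := by
  rw [expNeg, EReal.coe_ennreal_ofReal, max_eq_left hx, ← EReal.coe_neg, EReal.exp_coe]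

lemma continuous_expNeg : Continuous expNeg := by
  have h : Continuous EReal.exp := EReal.expHomeomorph.continuous
  exact h.comp (continuous_neg.comp continuous_coe_ennreal_ereal)

lemma measurable_expNeg : Measurable expNeg := continuous_expNeg.measurable

lemma expNeg_sum {ι : Type*} (s : Finset ι) (f : ι → ℝ≥0∞) :
    expNeg (∑ i ∈ s, f i) = ∏ i ∈ s, expNeg (f i) := by
  induction s using Finset.cons_induction with
  | empty => simp [expNeg_zero]
  | cons a s ha ih => rw [Finset.sum_cons, Finset.prod_cons, expNeg_add, ih]

lemma expNeg_mul_natCast (c : ℝ≥0∞) (n : ℕ) : expNeg (c * n) = expNeg c ^ n := by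
  have := expNeg_sum (Finset.range n) (fun _ => c)
  simpa [mul_comm] using this

/-- The exponential series at `μ q`, where `q = e^{-c}`. The value `c = ∞` is allowed: then `q = 0`
and only the empty configuration counts. -/
lemma lintegral_expNeg_mul_poissonMeasure (μ : ℝ≥0) (c : ℝ≥0∞) :
    ∫⁻ n, expNeg (c * (n : ℝ≥0∞)) ∂(poissonMeasure μ) = expNeg (μ * (1 - expNeg c)) := by
  obtain ⟨q, hq⟩ : ∃ q : ℝ≥0, expNeg c = q := ⟨_, (ENNReal.coe_toNNReal (expNeg_ne_top c)).symm⟩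
  have hq1 : (q : ℝ) ≤ 1 := by
    have := expNeg_le_one c
    rw [hq] at this
    exact_mod_cast this
  simp_rw [expNeg_mul_natCast, hq]
  rw [poissonMeasure, lintegral_sum_measure]
  simp_rw [lintegral_smul_measure, lintegral_dirac]
  have hs : HasSum (fun n : ℕ => Real.exp (-μ) * μ ^ n / n.factorial * (q : ℝ) ^ n)
      (Real.exp (-(μ * (1 - q)))) := by
    have h := (NormedSpace.expSeries_div_hasSum_exp (𝔸 := ℝ) ((μ : ℝ) * q)).mul_left
      (Real.exp (-μ))
    rw [← Real.exp_eq_exp_ℝ, ← Real.exp_add] at h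
    convert! h using 1
    · ext n; rw [mul_pow]; ring
    · congr 1; ring
  have h1 : (μ : ℝ≥0∞) * (1 - q) = ENNReal.ofReal (μ * (1 - q)) := by
    rw [ENNReal.ofReal_mul μ.coe_nonneg, ENNReal.ofReal_sub _ q.coe_nonneg]
    simp
  rw [h1, expNeg_ofReal (mul_nonneg μ.coe_nonneg (by linarith)), ← hs.tsum_eq,
    ENNReal.ofReal_tsum_of_nonneg (fun n => by positivity) hs.summable]
  congr with n
  rw [ENNReal.ofReal_mul (by positivity), smul_eq_mul, ENNReal.ofReal_pow q.coe_nonneg]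
  simp

lemma measurable_enatToENNReal : Measurable (fun n : ℕ∞ => (n : ℝ≥0∞)) := .of_discrete

/-- The counting measure of the configuration `{x 0, x 1, …}`. -/
def pointMeasure (x : ℕ → Plane) : Measure Plane := Measure.sum fun n => Measure.dirac (x n)

lemma lintegral_pointMeasure (x : ℕ → Plane) (f : Plane → ℝ≥0∞) :
    ∫⁻ z, f z ∂(pointMeasure x) = ∑' n, f (x n) := by
  rw [pointMeasure, lintegral_sum_measure]
  simp_rw [lintegral_dirac]

lemma pointMeasure_apply (x : ℕ → Plane) {A : Set Plane} (hA : MeasurableSet A) :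
    pointMeasure x A = (count x A : ℝ≥0∞) := by
  have hm : MeasurableSet {n | x n ∈ A} := .of_discrete
  rw [count, ← Measure.count_apply hm, ← lintegral_indicator_one hm, lintegral_count,
    ← lintegral_indicator_one hA, lintegral_pointMeasure]
  rfl

variable {Ω : Type*} [MeasurableSpace Ω] {P : Measure Ω} {lam : ℝ} {X : ℕ → Ω → Plane}

lemma IsPoissonProcess.measurable_tsum (hX : IsPoissonProcess P lam X) {f : Plane → ℝ≥0∞}
    (hf : Measurable f) : Measurable fun ω => ∑' n, f (X n ω) :=
  Measurable.tsum fun n => hf.comp (hX.measurable n)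

lemma IsPoissonProcess.measurable_pointMeasure (hX : IsPoissonProcess P lam X) {A : Set Plane}
    (hA : MeasurableSet A) : Measurable fun ω => pointMeasure (fun n => X n ω) A := by
  simp_rw [← lintegral_indicator_one hA, lintegral_pointMeasure]
  exact hX.measurable_tsum (measurable_one.indicator hA)

/-- No measurability of `g` is needed, because the count lives in the discrete space `ℕ∞`. -/
lemma IsPoissonProcess.lintegral_comp_count (hX : IsPoissonProcess P lam X) {A : Set Plane}
    (hA : MeasurableSet A) (hA' : volume A < ∞) (g : ℝ≥0∞ → ℝ≥0∞) :
    ∫⁻ ω, g (pointMeasure (fun n => X n ω) A) ∂P =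
      ∫⁻ n : ℕ, g n ∂(poissonMeasure (ENNReal.ofReal lam * volume A).toNNReal) := by
  simp_rw [pointMeasure_apply _ hA]
  have h := (hX.count_law A hA hA').lintegral_comp (f := fun n : ℕ∞ => g n)
    Measurable.of_discrete.aemeasurable
  rw [lintegral_map .of_discrete .of_discrete] at h
  simpa using h

lemma IsPoissonProcess.lintegral_expNeg_count (hX : IsPoissonProcess P lam X) {A : Set Plane}
    (hA : MeasurableSet A) (hA' : volume A < ∞) (c : ℝ≥0∞) :
    ∫⁻ ω, expNeg (c * pointMeasure (fun n => X n ω) A) ∂P =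
      expNeg (ENNReal.ofReal lam * ((1 - expNeg c) * volume A)) := by
  rw [hX.lintegral_comp_count hA hA' (fun t => expNeg (c * t)),
    lintegral_expNeg_mul_poissonMeasure, ENNReal.coe_toNNReal, mul_comm (1 - _), mul_assoc]
  exact ENNReal.mul_ne_top ENNReal.ofReal_ne_top hA'.ne

lemma IsPoissonProcess.iIndepFun_pointMeasure (hX : IsPoissonProcess P lam X) {ι : Type*}
    [Fintype ι] (A : ι → Set Plane) (hA : ∀ i, MeasurableSet (A i))
    (hd : Pairwise fun i j => Disjoint (A i) (A j)) :
    iIndepFun (fun i ω => pointMeasure (fun n => X n ω) (A i)) P := by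
  have e := Fintype.equivFin ι
  have h := hX.count_indep (Fintype.card ι) (fun j => A (e.symm j)) (fun j => hA _)
    (fun i j hij => hd (e.symm.injective.ne hij))
  have h2 := (h.precomp e.injective).comp (fun _ (n : ℕ∞) => (n : ℝ≥0∞))
    (fun _ => measurable_enatToENNReal)
  convert! h2 using 2 with i
  ext ω
  simp [pointMeasure_apply _ (hA i)]

/-- Laplace functional of a Poisson process on simple functions. -/
lemma IsPoissonProcess.lintegral_expNeg_simpleFunc [IsProbabilityMeasure P]
    (hX : IsPoissonProcess P lam X)
    (f : SimpleFunc Plane ℝ≥0∞) (hf : ∀ c ≠ 0, volume (f ⁻¹' {c}) < ∞) :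
    ∫⁻ ω, expNeg (∑' n, f (X n ω)) ∂P =
      expNeg (ENNReal.ofReal lam * ∫⁻ z, (1 - expNeg (f z))) := by
  -- Grouping the points by level sets of `f` gives a finite combination of independent Poisson
  -- counts, so the expectation factorises.
  have h1 : ∀ ω, ∑' n, f (X n ω) =
      ∑ c : f.range, (c : ℝ≥0∞) * pointMeasure (fun n => X n ω) (f ⁻¹' {(c : ℝ≥0∞)}) := by
    intro ω
    rw [← lintegral_pointMeasure (fun n => X n ω), SimpleFunc.lintegral_eq_lintegral,
      SimpleFunc.lintegral]
    exact (Finset.sum_coe_sort f.range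
      (fun c => c * pointMeasure (fun n => X n ω) (f ⁻¹' {c}))).symm
  have h2 : ∫⁻ z, (1 - expNeg (f z)) =
      ∑ c : f.range, (1 - expNeg c) * volume (f ⁻¹' {(c : ℝ≥0∞)}) := by
    have : (fun z => 1 - expNeg (f z)) = f.map (fun t => 1 - expNeg t) := by ext; simp
    rw [this, SimpleFunc.lintegral_eq_lintegral, SimpleFunc.map_lintegral]
    exact (Finset.sum_coe_sort f.range
      (fun c => (1 - expNeg c) * volume (f ⁻¹' {c}))).symm
  simp_rw [h1, h2, expNeg_sum, Finset.mul_sum, expNeg_sum]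
  have hind : iIndepFun (fun (c : f.range) ω => expNeg ((c : ℝ≥0∞) *
      pointMeasure (fun n => X n ω) (f ⁻¹' {(c : ℝ≥0∞)}))) P := by
    refine (hX.iIndepFun_pointMeasure (fun c : f.range => f ⁻¹' {(c : ℝ≥0∞)})
      (fun c => f.measurableSet_fiber _) ?_).comp (fun c t => expNeg ((c : ℝ≥0∞) * t))
      (fun c => measurable_expNeg.comp (measurable_const.mul measurable_id))
    intro c d hcd
    exact Disjoint.preimage _ (Set.disjoint_singleton.2 fun h => hcd (Subtype.ext h))
  rw [lintegral_prod_eq_prod_lintegral_of_indepFun _ _ hind]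
  · refine Finset.prod_congr rfl fun c _ => ?_
    -- The level set of 0 may have infinite area, where the count law says nothing; its factor is 1
    -- on both sides.
    by_cases hc : (c : ℝ≥0∞) = 0
    · simp [hc, expNeg_zero]
    · exact hX.lintegral_expNeg_count (f.measurableSet_fiber _) (hf _ hc) _
  · exact fun c => measurable_expNeg.comp
      ((hX.measurable_pointMeasure (f.measurableSet_fiber _)).const_mul _)

lemma tendsto_lintegral_expNeg [IsProbabilityMeasure P] {F : ℕ → Ω → ℝ≥0∞}
    (hF : ∀ k, Measurable (F k)) {G : Ω → ℝ≥0∞}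
    (h : ∀ ω, Tendsto (fun k => F k ω) atTop (𝓝 (G ω))) :
    Tendsto (fun k => ∫⁻ ω, expNeg (F k ω) ∂P) atTop (𝓝 (∫⁻ ω, expNeg (G ω) ∂P)) := by
  refine tendsto_lintegral_of_dominated_convergence (fun _ => 1)
    (fun k => measurable_expNeg.comp (hF k)) (fun k => .of_forall fun ω => expNeg_le_one _)
    (by simp) (.of_forall fun ω => (continuous_expNeg.tendsto _).comp (h ω))

/-- Laplace functional of a Poisson process. -/
theorem IsPoissonProcess.lintegral_expNeg_tsum [IsProbabilityMeasure P]
    (hX : IsPoissonProcess P lam X) {f : Plane → ℝ≥0∞} (hf : Measurable f) :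
    ∫⁻ ω, expNeg (∑' n, f (X n ω)) ∂P =
      expNeg (ENNReal.ofReal lam * ∫⁻ z, (1 - expNeg (f z))) := by
  -- Truncating to balls makes every nonzero level set of finite area while the approximation stays
  -- monotone.
  let g : ℕ → SimpleFunc Plane ℝ≥0∞ := fun k =>
    (SimpleFunc.eapprox f k).restrict (Metric.ball 0 k)
  have hg : ∀ k z, g k z = (Metric.ball (0 : Plane) k).indicator (SimpleFunc.eapprox f k) z :=
    fun k z => by rw [SimpleFunc.restrict_apply _ Metric.isOpen_ball.measurableSet]
  have hmono : ∀ z, Monotone fun k => g k z := by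
    intro z k l hkl
    simp only [hg]
    exact (Set.indicator_le_indicator_of_subset
      (Metric.ball_subset_ball (by exact_mod_cast hkl)) (by simp) z).trans
      (Set.indicator_le_indicator (SimpleFunc.monotone_eapprox f hkl z))
  have hlim : ∀ z, Tendsto (fun k => g k z) atTop (𝓝 (f z)) := by
    intro z
    have h1 : Tendsto (fun k => SimpleFunc.eapprox f k z) atTop (𝓝 (f z)) := by
      rw [← SimpleFunc.iSup_eapprox_apply hf z]
      exact tendsto_atTop_iSup fun k l hkl => SimpleFunc.monotone_eapprox f hkl z
    refine h1.congr' ?_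
    filter_upwards [eventually_gt_atTop ⌈dist z 0⌉₊] with k hk
    rw [hg, Set.indicator_of_mem]
    exact Metric.mem_ball.2 (lt_of_le_of_lt (Nat.le_ceil _) (by exact_mod_cast hk))
  have hfin : ∀ k, ∀ c ≠ 0, volume (g k ⁻¹' {c}) < ∞ := by
    intro k c hc
    refine lt_of_le_of_lt (measure_mono ?_) (measure_ball_lt_top (x := (0 : Plane)) (r := k))
    intro z hz
    by_contra hzk
    rw [Set.mem_preimage, hg, Set.indicator_of_notMem hzk, Set.mem_singleton_iff] at hz
    exact hc hz.symm
  have hL := tendsto_lintegral_expNeg (P := P)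
    (fun k => hX.measurable_tsum (g k).measurable) (G := fun ω => ∑' n, f (X n ω)) (by
      intro ω
      simp_rw [← lintegral_pointMeasure (fun n => X n ω)]
      exact lintegral_tendsto_of_tendsto_of_monotone (fun k => (g k).measurable.aemeasurable)
        (.of_forall hmono) (.of_forall hlim))
  have hR : Tendsto (fun k => expNeg (ENNReal.ofReal lam * ∫⁻ z, (1 - expNeg (g k z)))) atTop
      (𝓝 (expNeg (ENNReal.ofReal lam * ∫⁻ z, (1 - expNeg (f z))))) := by
    refine (continuous_expNeg.tendsto _).comp
      (ENNReal.Tendsto.const_mul ?_ (Or.inr ENNReal.ofReal_ne_top))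
    refine lintegral_tendsto_of_tendsto_of_monotone
      (fun k => (measurable_const.sub (measurable_expNeg.comp (g k).measurable)).aemeasurable)
      (.of_forall fun z k l hkl => tsub_le_tsub_left (expNeg_antitone (hmono z hkl)) _)
      (.of_forall fun z => ?_)
    exact ENNReal.Tendsto.sub tendsto_const_nhds ((continuous_expNeg.tendsto _).comp (hlim z))
      (Or.inl ENNReal.one_ne_top)
  refine tendsto_nhds_unique (hL.congr fun k => ?_) hR
  exact hX.lintegral_expNeg_simpleFunc (g k) (hfin k)

lemma IsPoissonProcess.lintegral_pointMeasure_apply (hX : IsPoissonProcess P lam X)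
    {A : Set Plane} (hA : MeasurableSet A) (hA' : volume A < ∞) :
    ∫⁻ ω, pointMeasure (fun n => X n ω) A ∂P = ENNReal.ofReal lam * volume A := by
  rw [hX.lintegral_comp_count hA hA' (fun t => t)]
  obtain ⟨μ, hμ⟩ : ∃ μ : ℝ≥0, ENNReal.ofReal lam * volume A = μ :=
    ⟨_, (ENNReal.coe_toNNReal (ENNReal.mul_ne_top ENNReal.ofReal_ne_top hA'.ne)).symm⟩
  rw [hμ, ENNReal.toNNReal_coe, poissonMeasure, lintegral_sum_measure]
  simp_rw [lintegral_smul_measure, lintegral_dirac]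
  -- The term `n = 0` vanishes; after the shift, `n e^{-μ} μ^n / n!` is `μ` times a Poisson weight,
  -- and these sum to 1.
  rw [tsum_eq_zero_add' ENNReal.summable]
  have h := (hasSum_one_poissonMeasure μ).mul_left (μ : ℝ)
  have h2 : ∀ n : ℕ, ENNReal.ofReal (Real.exp (-μ) * μ ^ (n + 1) / (n + 1).factorial) •
      ((n + 1 : ℕ) : ℝ≥0∞) = ENNReal.ofReal (μ * (Real.exp (-μ) * μ ^ n / n.factorial)) := by
    intro n
    rw [smul_eq_mul, ← ENNReal.ofReal_natCast, ← ENNReal.ofReal_mul (by positivity),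
      Nat.factorial_succ]
    congr 1
    push_cast
    field_simp
    ring
  simp_rw [h2]
  rw [← ENNReal.ofReal_tsum_of_nonneg (fun n => by positivity) h.summable, h.tsum_eq]
  simp

/-- Campbell's formula. -/
theorem IsPoissonProcess.lintegral_tsum (hX : IsPoissonProcess P lam X) {f : Plane → ℝ≥0∞}
    (hf : Measurable f) :
    ∫⁻ ω, ∑' n, f (X n ω) ∂P = ENNReal.ofReal lam * ∫⁻ z, f z := by
  have hg : ∀ g : Plane → ℝ≥0∞, Measurable g → ∫⁻ ω, ∑' n, g (X n ω) ∂P =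
      ∫⁻ z, g z ∂(Measure.sum fun n => P.map (X n)) := by
    intro g hg
    rw [lintegral_sum_measure,
      MeasureTheory.lintegral_tsum fun n => (hg.fun_comp (hX.measurable n)).aemeasurable]
    congr with n
    rw [lintegral_map hg (hX.measurable n)]
  -- The left side is the intensity measure. It suffices to identify it inside balls, where it is
  -- the mean of a Poisson count.
  have hμ : Measure.sum (fun n => P.map (X n)) = ENNReal.ofReal lam • volume := by
    refine Measure.ext_of_iUnion_eq_univ (s := fun k : ℕ => Metric.ball (0 : Plane) k)
      (Metric.iUnion_ball_nat 0) fun k => ?_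
    ext A hA
    have hm : MeasurableSet (A ∩ Metric.ball (0 : Plane) k) := hA.inter measurableSet_ball
    rw [Measure.restrict_apply hA, Measure.restrict_apply hA,
      Measure.smul_apply, smul_eq_mul, ← hX.lintegral_pointMeasure_apply hm
        ((measure_mono Set.inter_subset_right).trans_lt measure_ball_lt_top)]
    simp_rw [← lintegral_indicator_one hm, lintegral_pointMeasure]
    exact (hg _ (measurable_one.indicator hm)).symm
  rw [hg f hf, hμ, lintegral_smul_measure, smul_eq_mul]

end

/-! ### Void probabilities and the nearest station. -/

section

variable {Ω : Type*} [MeasurableSpace Ω] {P : Measure Ω} {lam : ℝ} {X : ℕ → Ω → Plane}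

lemma measurableSet_void (hX : IsPoissonProcess P lam X) {A : Set Plane} (hA : MeasurableSet A) :
    MeasurableSet {ω | ∀ n, X n ω ∉ A} := by
  simp only [Set.ofPred_forall]
  exact MeasurableSet.iInter fun n => (hX.measurable n) hA.compl

/-- Laplace functional restricted to the event that a region is void. -/
lemma IsPoissonProcess.setLIntegral_void [IsProbabilityMeasure P] (hX : IsPoissonProcess P lam X)
    {A : Set Plane} (hA : MeasurableSet A) {f : Plane → ℝ≥0∞} (hf : Measurable f)
    (hfA : ∀ z ∈ A, f z = 0) :
    ∫⁻ ω in {ω | ∀ n, X n ω ∉ A}, expNeg (∑' n, f (X n ω)) ∂P =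
      expNeg (ENNReal.ofReal lam * volume A) *
        expNeg (ENNReal.ofReal lam * ∫⁻ z, (1 - expNeg (f z))) := by
  -- Adding the weight `∞` on `A` annihilates every configuration with a point in `A` and leaves the
  -- others unchanged. The void event thus becomes part of the functional.
  have hi : Measurable (A.indicator fun _ => (∞ : ℝ≥0∞)) := measurable_const.indicator hA
  have h := hX.lintegral_expNeg_tsum (hi.add hf)
  have h1 : ∀ z, 1 - expNeg ((A.indicator (fun _ => (∞ : ℝ≥0∞)) + f) z) =
      A.indicator 1 z + (1 - expNeg (f z)) := by
    intro z
    by_cases hz : z ∈ A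
    · simp [hz, hfA z hz, expNeg_top, expNeg_zero]
    · simp [hz]
  rw [← lintegral_indicator (measurableSet_void hX hA), ← expNeg_add, ← mul_add,
    ← lintegral_indicator_one hA, ← lintegral_add_left (measurable_one.indicator hA)]
  simp_rw [h1] at h
  rw [← h]
  congr with ω
  by_cases hω : ω ∈ {ω | ∀ n, X n ω ∉ A}
  · rw [Set.indicator_of_mem hω]
    congr with n
    simp [Set.indicator_of_notMem (hω n)]
  · rw [Set.indicator_of_notMem hω]
    simp only [Set.mem_ofPred_eq, not_forall, not_not] at hω
    obtain ⟨n, hn⟩ := hω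
    have : ∑' n, (A.indicator (fun _ => (∞ : ℝ≥0∞)) + f) (X n ω) = ∞ :=
      ENNReal.tsum_eq_top_of_eq_top ⟨n, by simp [hn]⟩
    rw [this, expNeg_top]

/-- Void probabilities of a Poisson process. -/
lemma IsPoissonProcess.measure_void [IsProbabilityMeasure P] (hX : IsPoissonProcess P lam X)
    {A : Set Plane} (hA : MeasurableSet A) :
    P {ω | ∀ n, X n ω ∉ A} = expNeg (ENNReal.ofReal lam * volume A) := by
  have := hX.setLIntegral_void hA (f := fun _ => 0) measurable_const (by simp)
  simpa [expNeg_zero] using this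

lemma IsPoissonProcess.ae_notMem_of_volume_eq_zero [IsProbabilityMeasure P]
    (hX : IsPoissonProcess P lam X) {A : Set Plane} (hA : MeasurableSet A) (h0 : volume A = 0) :
    ∀ᵐ ω ∂P, ∀ n, X n ω ∉ A := by
  have h : P {ω | ∀ n, X n ω ∉ A} = 1 := by rw [hX.measure_void hA, h0, mul_zero, expNeg_zero]
  exact (prob_compl_eq_zero_iff (measurableSet_void hX hA)).2 h

/-- The weight at `n + 2` is at most `μ²` times the weight at `n`. The quadratic order is what makes
the union bound over many small cells vanish. -/
lemma poissonMeasure_two_le (μ : ℝ≥0) :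
    ∫⁻ n : ℕ, ({t | 2 ≤ t} : Set ℝ≥0∞).indicator 1 (n : ℝ≥0∞) ∂(poissonMeasure μ) ≤ μ ^ 2 := by
  rw [poissonMeasure, lintegral_sum_measure]
  simp_rw [lintegral_smul_measure, lintegral_dirac]
  rw [tsum_eq_zero_add' ENNReal.summable, tsum_eq_zero_add' ENNReal.summable]
  have h0 : ({t | 2 ≤ t} : Set ℝ≥0∞).indicator (1 : ℝ≥0∞ → ℝ≥0∞) ((0 : ℕ) : ℝ≥0∞) = 0 := by simp
  have h1 : ({t | 2 ≤ t} : Set ℝ≥0∞).indicator (1 : ℝ≥0∞ → ℝ≥0∞) ((0 + 1 : ℕ) : ℝ≥0∞) = 0 := by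
    simp
  rw [h0, h1, smul_zero, smul_zero, zero_add, zero_add]
  have h := (hasSum_one_poissonMeasure μ).mul_left ((μ : ℝ) ^ 2)
  have h2 : (μ : ℝ≥0∞) ^ 2 =
      ∑' n : ℕ, ENNReal.ofReal ((μ : ℝ) ^ 2 * (Real.exp (-μ) * μ ^ n / n.factorial)) := by
    rw [← ENNReal.ofReal_tsum_of_nonneg (fun n => by positivity) h.summable, h.tsum_eq,
      mul_one, ENNReal.ofReal_pow μ.coe_nonneg, ENNReal.ofReal_coe_nnreal]
  rw [h2]
  refine ENNReal.tsum_le_tsum fun n => ?_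
  calc _ ≤ ENNReal.ofReal (Real.exp (-μ) * μ ^ (n + 1 + 1) / (n + 1 + 1).factorial) * 1 := by
        rw [smul_eq_mul]
        exact mul_le_mul_right (Set.indicator_le_self' (by simp) _) _
    _ ≤ _ := by
        rw [mul_one]
        apply ENNReal.ofReal_le_ofReal
        have : (n.factorial : ℝ) ≤ (n + 1 + 1).factorial := by
          exact_mod_cast Nat.factorial_le (by omega)
        calc _ ≤ Real.exp (-μ) * (μ : ℝ) ^ (n + 1 + 1) / n.factorial := by gcongr
          _ = _ := by ring

lemma IsPoissonProcess.measure_two_le (hX : IsPoissonProcess P lam X) {A : Set Plane}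
    (hA : MeasurableSet A) (hA' : volume A < ∞) :
    P {ω | 2 ≤ pointMeasure (fun n => X n ω) A} ≤ (ENNReal.ofReal lam * volume A) ^ 2 := by
  have h := hX.lintegral_comp_count hA hA' (({t | 2 ≤ t} : Set ℝ≥0∞).indicator 1)
  have h2 := poissonMeasure_two_le (ENNReal.ofReal lam * volume A).toNNReal
  rw [ENNReal.coe_toNNReal (ENNReal.mul_ne_top ENNReal.ofReal_ne_top hA'.ne)] at h2
  refine le_trans (le_of_eq ?_) (h.trans_le h2)
  rw [← lintegral_indicator_one (measurableSet_le measurable_const (hX.measurable_pointMeasure hA))]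
  rfl

lemma two_le_pointMeasure {x : ℕ → Plane} {A : Set Plane} (hA : MeasurableSet A) {n m : ℕ}
    (hnm : n ≠ m) (hn : x n ∈ A) (hm : x m ∈ A) : 2 ≤ pointMeasure x A := by
  rw [← lintegral_indicator_one hA, lintegral_pointMeasure]
  refine le_trans ?_ (ENNReal.sum_le_tsum {n, m})
  rw [Finset.sum_pair hnm]
  simp [hn, hm, one_add_one_eq_two]

lemma volume_plane_ball (u : Plane) {r : ℝ} (hr : 0 ≤ r) :
    volume (Metric.ball u r) = ENNReal.ofReal (Real.pi * r ^ 2) := by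
  rw [EuclideanSpace.volume_ball_fin_two, ENNReal.ofReal_mul Real.pi_pos.le, mul_comm,
    ENNReal.ofReal_pow hr, ← NNReal.coe_real_pi, ENNReal.ofReal_coe_nnreal]

/-- Almost surely no two points of a Poisson process are at the same distance of a given site. -/
lemma IsPoissonProcess.ae_dist_ne [IsProbabilityMeasure P]
    (hX : IsPoissonProcess P lam X) (u : Plane) :
    ∀ᵐ ω ∂P, ∀ n m, n ≠ m → dist (X n ω) u ≠ dist (X m ω) u := by
  have key : ∀ M : ℕ, P {ω | ∃ n m, n ≠ m ∧ dist (X n ω) u = dist (X m ω) u ∧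
      dist (X n ω) u ^ 2 < M} = 0 := by
    intro M
    set E := {ω | ∃ n m, n ≠ m ∧ dist (X n ω) u = dist (X m ω) u ∧ dist (X n ω) u ^ 2 < M}
    have hb : ∀ K : ℕ, 0 < K → P E ≤ ENNReal.ofReal ((|lam| * Real.pi * M) ^ 2 / K) := by
      intro K hK
      -- Square-root spacing cuts the disc into `K` annuli of equal area `π M / K`. Two equidistant
      -- points share an annulus, so the union bound is `K` times `O(1/K²)`.
      let ρ : ℕ → ℝ := fun j => √(j * (M / K))
      let A : ℕ → Set Plane := fun j => Metric.ball u (ρ (j + 1)) \ Metric.ball u (ρ j)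
      have hAm : ∀ j, MeasurableSet (A j) := fun j => measurableSet_ball.diff measurableSet_ball
      have hAv : ∀ j, volume (A j) = ENNReal.ofReal (Real.pi * (M / K)) := by
        intro j
        rw [measure_sdiff (Metric.ball_subset_ball (Real.sqrt_le_sqrt (by gcongr; simp)))
          measurableSet_ball.nullMeasurableSet measure_ball_lt_top.ne,
          volume_plane_ball _ (Real.sqrt_nonneg _), volume_plane_ball _ (Real.sqrt_nonneg _),
          ← ENNReal.ofReal_sub _ (by positivity), Real.sq_sqrt (by positivity),
          Real.sq_sqrt (by positivity)]
        congr 1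
        push_cast
        ring
      have hsub : E ⊆ ⋃ j ∈ Finset.range K, {ω | 2 ≤ pointMeasure (fun n => X n ω) (A j)} := by
        rintro ω ⟨n, m, hnm, hd, hM⟩
        have hK' : (0 : ℝ) < K := by exact_mod_cast hK
        have hM' : (0 : ℝ) < M := lt_of_le_of_lt (sq_nonneg _) hM
        have hq : (0 : ℝ) < M / K := by positivity
        set j := ⌊dist (X n ω) u ^ 2 / (M / K)⌋₊ with hj
        have hj1 : j * (M / K) ≤ dist (X n ω) u ^ 2 := by
          rw [← le_div_iff₀ hq]; exact Nat.floor_le (by positivity)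
        have hj2 : dist (X n ω) u ^ 2 < ((j + 1 : ℕ) : ℝ) * (M / K) := by
          rw [← div_lt_iff₀ hq]; push_cast; exact Nat.lt_floor_add_one _
        have hmem : ∀ i, dist (X i ω) u = dist (X n ω) u → X i ω ∈ A j := by
          intro i hi
          refine ⟨?_, ?_⟩
          · rw [Metric.mem_ball, hi]; exact Real.lt_sqrt_of_sq_lt hj2
          · rw [Metric.mem_ball, hi, not_lt]
            exact (Real.sqrt_le_left dist_nonneg).2 hj1
        have hjK : j < K := by
          rw [hj, Nat.floor_lt (by positivity), div_lt_iff₀ hq]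
          calc _ < (M : ℝ) := hM
            _ = _ := by field_simp
        simp only [Set.mem_iUnion, Finset.mem_range]
        exact ⟨j, hjK, two_le_pointMeasure (hAm j) hnm (hmem n rfl) (hmem m hd.symm)⟩
      calc P E ≤ ∑ j ∈ Finset.range K, P {ω | 2 ≤ pointMeasure (fun n => X n ω) (A j)} :=
            (measure_mono hsub).trans (measure_biUnion_finset_le _ _)
        _ ≤ ∑ j ∈ Finset.range K, ENNReal.ofReal ((|lam| * (Real.pi * (M / K))) ^ 2) := by
            refine Finset.sum_le_sum fun j _ => (hX.measure_two_le (hAm j) (by simp [hAv])).trans ?_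
            rw [hAv, ENNReal.ofReal_pow (by positivity), ENNReal.ofReal_mul (abs_nonneg _)]
            gcongr
            exact le_abs_self _
        _ = _ := by
            rw [Finset.sum_const, Finset.card_range, nsmul_eq_mul, ← ENNReal.ofReal_natCast,
              ← ENNReal.ofReal_mul (by positivity)]
            congr 1
            have hK' : (0 : ℝ) < K := by exact_mod_cast hK
            field_simp
    have hlim : Tendsto (fun K : ℕ => ENNReal.ofReal ((|lam| * Real.pi * M) ^ 2 / K)) atTop
        (𝓝 0) := by
      rw [← ENNReal.ofReal_zero]
      exact (ENNReal.continuous_ofReal.tendsto _).comp (tendsto_const_div_atTop_nhds_zero_nat _)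
    exact le_antisymm (ge_of_tendsto hlim ((eventually_gt_atTop 0).mono hb)) bot_le
  have key' : ∀ᵐ ω ∂P, ∀ M : ℕ, ¬ ∃ n m, n ≠ m ∧ dist (X n ω) u = dist (X m ω) u ∧
      dist (X n ω) u ^ 2 < M := by
    rw [ae_all_iff]
    intro M
    rw [ae_iff]
    simpa using key M
  filter_upwards [key'] with ω hω n m hnm hd
  obtain ⟨M, hM⟩ := exists_nat_gt (dist (X n ω) u ^ 2)
  exact hω M ⟨n, m, hnm, hd, hM⟩

lemma IsPoissonProcess.ae_pointMeasure_ball_lt_top [IsProbabilityMeasure P]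
    (hX : IsPoissonProcess P lam X) (u : Plane) :
    ∀ᵐ ω ∂P, ∀ k : ℕ, pointMeasure (fun n => X n ω) (Metric.ball u k) < ∞ := by
  rw [ae_all_iff]
  intro k
  refine ae_lt_top (hX.measurable_pointMeasure measurableSet_ball) ?_
  rw [hX.lintegral_pointMeasure_apply measurableSet_ball measure_ball_lt_top]
  exact ENNReal.mul_ne_top ENNReal.ofReal_ne_top measure_ball_lt_top.ne

/-- Almost surely there is a unique nearest station. -/
lemma IsPoissonProcess.ae_exists_isNearest [IsProbabilityMeasure P]
    (hX : IsPoissonProcess P lam X) (u : Plane) :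
    ∀ᵐ ω ∂P, ∃ k, IsNearest u (fun n => X n ω) k := by
  filter_upwards [hX.ae_dist_ne u, hX.ae_pointMeasure_ball_lt_top u] with ω h1 h2
  obtain ⟨K, hK⟩ := exists_nat_gt (dist (X 0 ω) u)
  -- The ball contains `X 0 ω` and finitely many stations, so a nearest one exists; the absence of
  -- ties makes it strictly nearest.
  have hfin : {n | X n ω ∈ Metric.ball u K}.Finite := by
    have := h2 K
    rw [pointMeasure_apply _ measurableSet_ball] at this
    rw [← Set.encard_lt_top_iff]
    simpa [count] using this
  obtain ⟨k, hk, hmin⟩ := hfin.exists_minimalFor (fun n => dist (X n ω) u) _ ⟨0, hK⟩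
  refine ⟨k, fun n hn => ?_⟩
  refine lt_of_le_of_ne ?_ (h1 k n hn.symm)
  by_contra! hlt
  have := hmin (j := n) (lt_trans hlt hk) hlt.le
  exact absurd hlt (not_lt.2 this)

/-- Distance from `u` to the nearest station. -/
def distToNearest (X : ℕ → Ω → Plane) (u : Plane) (ω : Ω) : ℝ := ⨅ n, dist (X n ω) u

omit [MeasurableSpace Ω] in
lemma IsNearest.distToNearest_eq {u : Plane} {ω : Ω} {k : ℕ}
    (hk : IsNearest u (fun n => X n ω) k) : distToNearest X u ω = dist (X k ω) u := by
  refine le_antisymm (ciInf_le ⟨0, by rintro _ ⟨n, rfl⟩; exact dist_nonneg⟩ k)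
    (le_ciInf fun n => ?_)
  rcases eq_or_ne n k with rfl | hn
  · rfl
  · exact (hk n hn).le

omit [MeasurableSpace Ω] in
lemma distToNearest_nonneg (u : Plane) (ω : Ω) : 0 ≤ distToNearest X u ω :=
  Real.iInf_nonneg fun _ => dist_nonneg

lemma IsPoissonProcess.measurable_distToNearest (hX : IsPoissonProcess P lam X) (u : Plane) :
    Measurable (distToNearest X u) :=
  Measurable.iInf fun n => (hX.measurable n).dist measurable_const

omit [MeasurableSpace Ω] in
-- With open balls the equivalence needs no attained infimum. It turns tails of the nearest distance
-- into void probabilities.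
lemma le_distToNearest_iff {u : Plane} {ω : Ω} {t : ℝ} :
    t ≤ distToNearest X u ω ↔ ∀ n, X n ω ∉ Metric.ball u t := by
  rw [distToNearest, le_ciInf_iff ⟨0, by rintro _ ⟨n, rfl⟩; exact dist_nonneg⟩]
  simp

lemma IsPoissonProcess.measure_le_distToNearest [IsProbabilityMeasure P]
    (hX : IsPoissonProcess P lam X) (u : Plane) (t : ℝ) :
    P {ω | t ≤ distToNearest X u ω} =
      expNeg (ENNReal.ofReal lam * volume (Metric.ball u t)) := by
  simp_rw [le_distToNearest_iff]
  exact hX.measure_void measurableSet_ball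

lemma IsPoissonProcess.ae_distToNearest_pos [IsProbabilityMeasure P]
    (hX : IsPoissonProcess P lam X) (u : Plane) : ∀ᵐ ω ∂P, 0 < distToNearest X u ω := by
  filter_upwards [hX.ae_exists_isNearest u,
    hX.ae_notMem_of_volume_eq_zero (measurableSet_singleton u) (by simp)] with ω ⟨k, hk⟩ h0
  rw [hk.distToNearest_eq]
  exact dist_pos.2 (h0 k)

/-- The law of the distance to the nearest station does not depend on the site. -/
lemma IsPoissonProcess.map_distToNearest [IsProbabilityMeasure P]
    (hX : IsPoissonProcess P lam X) (u : Plane) :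
    P.map (distToNearest X u) = P.map (nearestDist X) := by
  have h : ∀ v, IsProbabilityMeasure (P.map (distToNearest X v)) := fun v =>
    Measure.isProbabilityMeasure_map (hX.measurable_distToNearest v).aemeasurable
  have := h u
  change _ = P.map (distToNearest X 0)
  have := h 0
  -- Closed upper tails determine the law, and each depends only on the area of a ball.
  refine Measure.ext_of_Ici _ _ fun t => ?_
  rw [Measure.map_apply (hX.measurable_distToNearest _) measurableSet_Ici,
    Measure.map_apply (hX.measurable_distToNearest _) measurableSet_Ici]
  change P {ω | t ≤ distToNearest X u ω} = P {ω | t ≤ distToNearest X 0 ω}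
  rw [hX.measure_le_distToNearest, hX.measure_le_distToNearest, Measure.addHaar_ball_center]

end

/-! ### Rayleigh fading. -/

section

lemma lintegral_Ioi_mul_exp_neg_sq {a b : ℝ} (ha : 0 ≤ a) (hb : 0 < b) :
    ∫⁻ r in Set.Ioi a, ENNReal.ofReal (2 * r * Real.exp (-b * r ^ 2)) =
      ENNReal.ofReal (Real.exp (-b * a ^ 2) / b) := by
  have hd : ∀ r ∈ Set.Ioi a, HasDerivAt (fun r => -(Real.exp (-b * r ^ 2) / b))
      (2 * r * Real.exp (-b * r ^ 2)) r := by
    intro r _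
    have h1 : HasDerivAt (fun r : ℝ => -b * r ^ 2) (-b * (2 * r)) r := by
      simpa using (hasDerivAt_pow 2 r).const_mul (-b)
    convert! (h1.exp.div_const b).neg using 1
    field_simp
  have hpos : ∀ r ∈ Set.Ioi a, 0 ≤ 2 * r * Real.exp (-b * r ^ 2) := by
    intro r hr
    have : 0 < r := lt_of_le_of_lt ha hr
    positivity
  have hcont : ContinuousWithinAt (fun r => -(Real.exp (-b * r ^ 2) / b)) (Set.Ici a) a := by
    fun_prop
  have hlim : Tendsto (fun r => -(Real.exp (-b * r ^ 2) / b)) atTop (𝓝 0) := by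
    have h1 : Tendsto (fun r : ℝ => -b * r ^ 2) atTop atBot :=
      (tendsto_pow_atTop two_ne_zero).const_mul_atTop_of_neg (by linarith)
    simpa using ((Real.tendsto_exp_atBot.comp h1).div_const b).neg
  rw [← ofReal_integral_eq_lintegral_ofReal
    (integrableOn_Ioi_deriv_of_nonneg hcont hd hpos hlim)
    ((ae_restrict_iff' measurableSet_Ioi).2 (.of_forall hpos)),
    integral_Ioi_of_hasDerivAt_of_nonneg hcont hd hpos hlim]
  simp

lemma gaussianPDF_half (x : ℝ) :
    gaussianPDF 0 (1 / 2) x = ENNReal.ofReal ((√Real.pi)⁻¹ * Real.exp (-x ^ 2)) := by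
  have h : ((1 / 2 : ℝ≥0) : ℝ) = 1 / 2 := by norm_num
  rw [gaussianPDF, gaussianPDFReal, h, sub_zero]
  congr 2
  · congr 2; ring
  · congr 1; ring

/-- The modulus of a `CN(0,1)` variable has the Rayleigh density `2 r exp (-r²)`. -/
lemma lintegral_norm_stdComplexGaussian {f : ℝ → ℝ≥0∞} (hf : Measurable f) :
    ∫⁻ z, f ‖z‖ ∂stdComplexGaussian =
      ∫⁻ r in Set.Ioi 0, ENNReal.ofReal (2 * r * Real.exp (-1 * r ^ 2)) * f r := by
  have hm : Measurable (fun p : ℝ × ℝ => (⟨p.1, p.2⟩ : ℂ)) :=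
    Complex.measurableEquivRealProd.symm.measurable
  have hpdf : Measurable fun p : ℝ × ℝ => gaussianPDF 0 (1 / 2) p.1 * gaussianPDF 0 (1 / 2) p.2 :=
    ((measurable_gaussianPDF _ _).comp measurable_fst).mul
      ((measurable_gaussianPDF _ _).comp measurable_snd)
  rw [stdComplexGaussian, lintegral_map (hf.fun_comp measurable_norm) hm,
    gaussianReal_of_var_ne_zero _ (by simp),
    prod_withDensity (measurable_gaussianPDF _ _) (measurable_gaussianPDF _ _),
    lintegral_withDensity_eq_lintegral_mul _ hpdf
      ((hf.fun_comp measurable_norm).fun_comp hm), ← Measure.volume_eq_prod,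
    ← lintegral_comp_polarCoord_symm, polarCoord_target, Measure.volume_eq_prod,
    ← Measure.prod_restrict]
  have hint : ∀ p : ℝ × ℝ, ENNReal.ofReal p.1 • ((fun p : ℝ × ℝ =>
      gaussianPDF 0 (1 / 2) p.1 * gaussianPDF 0 (1 / 2) p.2) *
      fun p : ℝ × ℝ => f ‖(⟨p.1, p.2⟩ : ℂ)‖) (polarCoord.symm p) =
      ENNReal.ofReal p.1 * (ENNReal.ofReal (Real.pi⁻¹ * Real.exp (-p.1 ^ 2)) * f |p.1|) := by
    intro p
    have h1 : ‖(⟨p.1 * Real.cos p.2, p.1 * Real.sin p.2⟩ : ℂ)‖ = |p.1| := by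
      rw [Complex.norm_def, Complex.normSq_mk, ← Real.sqrt_sq_eq_abs]
      congr 1
      linear_combination p.1 ^ 2 * Real.cos_sq_add_sin_sq p.2
    simp only [Pi.mul_apply, polarCoord_symm_apply, h1, gaussianPDF_half, smul_eq_mul]
    rw [← ENNReal.ofReal_mul (by positivity)]
    congr 3
    rw [mul_mul_mul_comm, ← mul_inv, Real.mul_self_sqrt Real.pi_pos.le, ← Real.exp_add]
    congr 2
    linear_combination -p.1 ^ 2 * Real.cos_sq_add_sin_sq p.2
  simp_rw [hint]
  rw [lintegral_prod _ (by fun_prop)]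
  -- The integrand is independent of the angle: the length `2π` against the constant `1/π` of the
  -- Gaussian density produces the factor 2.
  simp_rw [lintegral_const]
  refine setLIntegral_congr_fun measurableSet_Ioi fun r hr => ?_
  have hr' : (0 : ℝ) < r := hr
  simp only [Measure.restrict_apply_univ, Real.volume_Ioo]
  rw [abs_of_pos hr', ← mul_assoc, ← ENNReal.ofReal_mul hr'.le, mul_right_comm,
    ← ENNReal.ofReal_mul (by positivity)]
  congr 2
  have := Real.pi_pos.ne'
  field_simp
  ring_nf

lemma enorm_sq_eq_ofReal (z : ℂ) : ‖z‖ₑ ^ 2 = ENNReal.ofReal (‖z‖ ^ 2) := by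
  rw [ENNReal.ofReal_pow (norm_nonneg _), ofReal_norm]

/-- The squared modulus of a `CN(0,1)` variable is exponential of mean `1`. -/
lemma stdComplexGaussian_le_sq (t : ℝ≥0∞) :
    stdComplexGaussian {z | t ≤ ‖z‖ₑ ^ 2} = expNeg t := by
  rcases eq_or_ne t ∞ with rfl | ht
  · simp [expNeg_top]
  obtain ⟨s, hs, rfl⟩ : ∃ s : ℝ, 0 ≤ s ∧ t = ENNReal.ofReal s :=
    ⟨t.toReal, ENNReal.toReal_nonneg, (ENNReal.ofReal_toReal ht).symm⟩
  have h1 : {z : ℂ | ENNReal.ofReal s ≤ ‖z‖ₑ ^ 2} = {z | √s ≤ ‖z‖} := by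
    ext z
    simp only [Set.mem_ofPred_eq]
    rw [enorm_sq_eq_ofReal, ENNReal.ofReal_le_ofReal_iff (by positivity),
      Real.sqrt_le_left (norm_nonneg _)]
  have hm : MeasurableSet {z : ℂ | √s ≤ ‖z‖} := measurableSet_le measurable_const measurable_norm
  have h2 := lintegral_norm_stdComplexGaussian (f := (Set.Ici √s).indicator 1)
    (measurable_one.indicator measurableSet_Ici)
  rw [h1, ← lintegral_indicator_one hm, expNeg_ofReal hs]
  refine h2.trans ?_
  have h3 := lintegral_Ioi_mul_exp_neg_sq (Real.sqrt_nonneg s) one_pos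
  rw [Real.sq_sqrt hs, div_one, neg_one_mul] at h3
  rw [← h3, setLIntegral_congr Ioi_ae_eq_Ici, ← lintegral_indicator measurableSet_Ici,
    setLIntegral_congr Ioi_ae_eq_Ici, ← lintegral_indicator measurableSet_Ici]
  congr with r
  by_cases hr : r ∈ Set.Ici √s
  · have : r ∈ Set.Ici (0 : ℝ) := (Real.sqrt_nonneg s).trans hr
    simp [hr, this]
  · simp [hr, Set.indicator]

/-- The Laplace transform `1/(1 + w)` of the unit exponential law, put in the form `exp(-log(1 +
w))` so that the product over interferers becomes a sum over points. -/
lemma lintegral_expNeg_stdComplexGaussian {w : ℝ} (hw : 0 ≤ w) :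
    ∫⁻ z, expNeg (ENNReal.ofReal w * ‖z‖ₑ ^ 2) ∂stdComplexGaussian =
      expNeg (ENNReal.ofReal (Real.log (1 + w))) := by
  have h := lintegral_norm_stdComplexGaussian
    (f := fun r => ENNReal.ofReal (Real.exp (-(w * r ^ 2)))) (by fun_prop)
  have h1 : ∀ z : ℂ, expNeg (ENNReal.ofReal w * ‖z‖ₑ ^ 2) =
      ENNReal.ofReal (Real.exp (-(w * ‖z‖ ^ 2))) := by
    intro z
    rw [enorm_sq_eq_ofReal, ← ENNReal.ofReal_mul hw, expNeg_ofReal (by positivity)]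
  simp_rw [h1]
  have h3 := lintegral_Ioi_mul_exp_neg_sq le_rfl (b := 1 + w) (by linarith)
  rw [h, expNeg_ofReal (Real.log_nonneg (by linarith)), Real.exp_neg, Real.exp_log (by linarith)]
  simp only [ne_eq, OfNat.ofNat_ne_zero, not_false_eq_true, zero_pow, mul_zero, Real.exp_zero,
    one_div] at h3
  rw [← h3]
  refine setLIntegral_congr_fun measurableSet_Ioi fun r hr => ?_
  have hr' : (0 : ℝ) < r := hr
  rw [← ENNReal.ofReal_mul (by positivity), mul_assoc, ← Real.exp_add]
  congr 4
  ring

variable {Ω : Type*} [MeasurableSpace Ω] {P : Measure Ω} {h : ℕ → Ω → ℂ}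

/-- By Fubini one may freeze `A`; the tail of the unit exponential variable `B` at level `c + A` is
then `expNeg (c + A)`. -/
lemma measure_add_le_of_indepFun [IsProbabilityMeasure P] {A B : Ω → ℝ≥0∞} (hA : Measurable A)
    (hB : Measurable B) (hAB : IndepFun A B P) (hBlaw : ∀ t, P {ω | t ≤ B ω} = expNeg t)
    (c : ℝ≥0∞) : P {ω | c + A ω ≤ B ω} = ∫⁻ ω, expNeg (c + A ω) ∂P := by
  have hs : MeasurableSet {p : ℝ≥0∞ × ℝ≥0∞ | c + p.1 ≤ p.2} :=
    measurableSet_le (measurable_const.add measurable_fst) measurable_snd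
  have h1 : P {ω | c + A ω ≤ B ω} = P.map (fun ω => (A ω, B ω)) {p | c + p.1 ≤ p.2} := by
    rw [Measure.map_apply (hA.prodMk hB) hs]; rfl
  rw [h1, hAB.map_prod_eq_prod_map_map hA.aemeasurable hB.aemeasurable, Measure.prod_apply hs]
  have h2 : ∀ a, P.map B (Prod.mk a ⁻¹' {p | c + p.1 ≤ p.2}) = expNeg (c + a) := by
    intro a
    rw [Measure.map_apply hB (measurable_prodMk_left hs), ← hBlaw]
    rfl
  simp_rw [h2]
  rw [lintegral_map (f := fun a => expNeg (c + a))
    (measurable_expNeg.comp (measurable_id.const_add c)) hA]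

/-- Success probability under Rayleigh fading with finitely many interferers. -/
lemma measure_add_sum_le_fading [IsProbabilityMeasure P]
    (hh : ∀ n, Measurable (h n)) (hlaw : ∀ n, HasLaw (h n) stdComplexGaussian P)
    (hind : iIndepFun h P) (k : ℕ) (c : ℝ≥0∞) {w : ℕ → ℝ} (hw : ∀ n, 0 ≤ w n)
    (s : Finset ℕ) (hk : k ∉ s) :
    P {ω | c + ∑ n ∈ s, ENNReal.ofReal (w n) * ‖h n ω‖ₑ ^ 2 ≤ ‖h k ω‖ₑ ^ 2} =
      expNeg (c + ∑ n ∈ s, ENNReal.ofReal (Real.log (1 + w n))) := by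
  -- Giving weight 1 to index `k` puts the signal and the interferers in a single independent
  -- family.
  let v : ℕ → ℝ≥0∞ := fun n => if n = k then 1 else ENNReal.ofReal (w n)
  let Z : ℕ → Ω → ℝ≥0∞ := fun n ω => v n * ‖h n ω‖ₑ ^ 2
  have hφ : ∀ n, Measurable fun z : ℂ => v n * ‖z‖ₑ ^ 2 := fun n =>
    (measurable_enorm.pow_const 2).const_mul _
  have hZm : ∀ n, Measurable (Z n) := fun n => (hφ n).comp (hh n)
  have hZ : iIndepFun Z P := hind.comp (fun n z => v n * ‖z‖ₑ ^ 2) hφ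
  have hv : ∀ n ∈ s, v n = ENNReal.ofReal (w n) := fun n hn => by
    have : n ≠ k := fun h => hk (h ▸ hn)
    simp [v, this]
  have hvk : v k = 1 := by simp [v]
  have hZk : ∀ t, P {ω | t ≤ Z k ω} = expNeg t := by
    intro t
    rw [← stdComplexGaussian_le_sq t, ← (hlaw k).measure_eq (p := fun z => t ≤ ‖z‖ₑ ^ 2)
      (measurableSet_le measurable_const (measurable_enorm.pow_const 2))]
    simp [Z, hvk]
  have hsum : Measurable (∑ n ∈ s, Z n) := by
    simpa only [← Finset.sum_apply] using Finset.measurable_sum s fun n _ => hZm n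
  have key := measure_add_le_of_indepFun hsum (hZm k)
    (hZ.indepFun_finsetSum_of_notMem hZm hk) hZk c
  have h1 : {ω | c + ∑ n ∈ s, ENNReal.ofReal (w n) * ‖h n ω‖ₑ ^ 2 ≤ ‖h k ω‖ₑ ^ 2} =
      {ω | c + (∑ n ∈ s, Z n) ω ≤ Z k ω} := by
    ext ω
    simp only [Set.mem_ofPred_eq, Finset.sum_apply, Z, hvk, one_mul]
    rw [Finset.sum_congr rfl fun n hn => by rw [← hv n hn]]
  rw [h1, key]
  simp_rw [Finset.sum_apply, expNeg_add, expNeg_sum]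
  rw [lintegral_const_mul _ (Finset.measurable_fun_prod _ fun n _ => measurable_expNeg.fun_comp (hZm n)),
    lintegral_prod_eq_prod_lintegral_of_indepFun s (fun n ω => expNeg (Z n ω))
      (hZ.comp (fun _ => expNeg) fun _ => measurable_expNeg)
      (fun n => measurable_expNeg.comp (hZm n))]
  congr 1
  refine Finset.prod_congr rfl fun n hn => ?_
  rw [← lintegral_expNeg_stdComplexGaussian (hw n), ← hv n hn]
  exact (hlaw n).lintegral_comp (f := fun z => expNeg (v n * ‖z‖ₑ ^ 2))
    (measurable_expNeg.comp (hφ n)).aemeasurable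

/-- Success probability under Rayleigh fading with countably many interferers. -/
theorem measure_add_tsum_le_fading [IsProbabilityMeasure P]
    (hh : ∀ n, Measurable (h n)) (hlaw : ∀ n, HasLaw (h n) stdComplexGaussian P)
    (hind : iIndepFun h P) (k : ℕ) (c : ℝ≥0∞) {w : ℕ → ℝ} (hw : ∀ n, 0 ≤ w n) (hwk : w k = 0) :
    P {ω | c + ∑' n, ENNReal.ofReal (w n) * ‖h n ω‖ₑ ^ 2 ≤ ‖h k ω‖ₑ ^ 2} =
      expNeg (c + ∑' n, ENNReal.ofReal (Real.log (1 + w n))) := by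
  have herase : ∀ (N : ℕ) (a : ℕ → ℝ≥0∞), a k = 0 →
      ∑ n ∈ (Finset.range N).erase k, a n = ∑ n ∈ Finset.range N, a n :=
    fun N a ha => Finset.sum_erase _ ha
  have hfin : ∀ N : ℕ,
      P {ω | c + ∑ n ∈ Finset.range N, ENNReal.ofReal (w n) * ‖h n ω‖ₑ ^ 2 ≤ ‖h k ω‖ₑ ^ 2} =
        expNeg (c + ∑ n ∈ Finset.range N, ENNReal.ofReal (Real.log (1 + w n))) := by
    intro N
    have := measure_add_sum_le_fading hh hlaw hind k c hw ((Finset.range N).erase k) (by simp)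
    rw [herase N _ (by simp [hwk])] at this
    rw [← this]
    congr with ω
    rw [herase N _ (by simp [hwk])]
  -- Partial sums increase to the series, so the events for finitely many interferers decrease to
  -- this one, and continuity from above applies.
  have hset : {ω | c + ∑' n, ENNReal.ofReal (w n) * ‖h n ω‖ₑ ^ 2 ≤ ‖h k ω‖ₑ ^ 2} =
      ⋂ N : ℕ, {ω | c + ∑ n ∈ Finset.range N, ENNReal.ofReal (w n) * ‖h n ω‖ₑ ^ 2 ≤
        ‖h k ω‖ₑ ^ 2} := by
    ext ω
    simp only [Set.mem_ofPred_eq, Set.mem_iInter]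
    rw [ENNReal.tsum_eq_iSup_nat, ENNReal.add_iSup, iSup_le_iff]
  have hmeas : ∀ N : ℕ, MeasurableSet {ω |
      c + ∑ n ∈ Finset.range N, ENNReal.ofReal (w n) * ‖h n ω‖ₑ ^ 2 ≤ ‖h k ω‖ₑ ^ 2} := by
    intro N
    refine measurableSet_le (measurable_const.add (Finset.measurable_fun_sum _ fun n _ => ?_))
      ((hh k).enorm.pow_const 2)
    exact ((hh n).enorm.pow_const 2).const_mul _
  rw [hset]
  refine tendsto_nhds_unique (tendsto_measure_iInter_atTop (fun N => (hmeas N).nullMeasurableSet)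
    ?_ ⟨0, measure_ne_top _ _⟩) ?_
  · intro N M hNM ω hω
    have hω' : c + ∑ n ∈ Finset.range M, ENNReal.ofReal (w n) * ‖h n ω‖ₑ ^ 2 ≤ ‖h k ω‖ₑ ^ 2 := hω
    refine le_trans (add_le_add_right (Finset.sum_le_sum_of_subset ?_) _) hω'
    exact Finset.range_mono hNM
  · refine Tendsto.congr (fun N => (hfin N).symm) ?_
    exact (continuous_expNeg.tendsto _).comp
      (ENNReal.summable.hasSum.tendsto_sum_nat.const_add c)

end

/-! ### Coverage for a given configuration of stations. -/

section

/-- The relative weight `T (s / ‖z - u‖)^α` of an interferer at `z` outside the region `C` and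
farther than `t` from `u`, transformed by `G`. -/
def extField (G : ℝ → ℝ) (α T : ℝ) (C : Set Plane) (u : Plane) (s t : ℝ) (z : Plane) : ℝ≥0∞ :=
  {z | z ∉ C ∧ t < dist z u}.indicator (fun z => ENNReal.ofReal (G (T * (s / dist z u) ^ α))) z

lemma extField_of_mem (G : ℝ → ℝ) (α T : ℝ) {C : Set Plane} {u : Plane} (s : ℝ) {t : ℝ} {z : Plane}
    (hz : z ∉ C) (ht : t < dist z u) :
    extField G α T C u s t z = ENNReal.ofReal (G (T * (s / dist z u) ^ α)) :=
  Set.indicator_of_mem (s := {z | z ∉ C ∧ t < dist z u}) ⟨hz, ht⟩ _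

lemma extField_of_mem_region (G : ℝ → ℝ) (α T : ℝ) {C : Set Plane} (u : Plane) (s t : ℝ)
    {z : Plane} (hz : z ∈ C) : extField G α T C u s t z = 0 :=
  Set.indicator_of_notMem (s := {z | z ∉ C ∧ t < dist z u}) (fun h => h.1 hz) _

lemma measurableSet_exterior {C : Set Plane} (hC : MeasurableSet C) (u : Plane) (t : ℝ) :
    MeasurableSet {z | z ∉ C ∧ t < dist z u} :=
  hC.compl.inter (measurableSet_lt measurable_const (measurable_id.dist measurable_const))

lemma measurable_extField {G : ℝ → ℝ} (hG : Measurable G) (α T : ℝ) {C : Set Plane}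
    (hC : MeasurableSet C) (u : Plane) (s t : ℝ) : Measurable (extField G α T C u s t) := by
  refine Measurable.indicator ?_ (measurableSet_exterior hC u t)
  fun_prop

/-- Multiply out the quotient, then multiply by `r^α`. A nonzero finite signal makes this legitimate
in `[0, ∞]` even when noise and interference both vanish; with `g k = 0` the value `0/0 = 0` would
break the equivalence. -/
lemma sinr_ge_iff {α σ T : ℝ} (hT : 0 < T) {u : Plane} {C : Set Plane} {x : ℕ → Plane}
    {g : ℕ → ℂ} {k : ℕ} (hpos : ∀ n, 0 < dist (x n) u) (hg : g k ≠ 0) :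
    ENNReal.ofReal T ≤ sinr α σ u C x g k ↔
      ENNReal.ofReal (T * σ ^ 2 * dist (x k) u ^ α) +
        ∑' n, ENNReal.ofReal ({n | n ≠ k ∧ x n ∉ C}.indicator
          (fun n => T * (dist (x k) u / dist (x n) u) ^ α) n) * ‖g n‖ₑ ^ 2 ≤ ‖g k‖ₑ ^ 2 := by
  have hr := hpos k
  set r := dist (x k) u with hr_def
  have hrα : 0 < r ^ α := Real.rpow_pos_of_pos hr α
  have hpow : edist (x k) u ^ (-α) = (ENNReal.ofReal (r ^ α))⁻¹ := by
    rw [edist_dist, ENNReal.ofReal_rpow_of_pos hr, Real.rpow_neg hr.le,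
      ENNReal.ofReal_inv_of_pos hrα]
  have hg0 : ‖g k‖ₑ ^ 2 ≠ 0 := by simpa using hg
  have hgt : ‖g k‖ₑ ^ 2 ≠ ∞ := by simp
  have hq0 : ENNReal.ofReal (r ^ α) ≠ 0 := by simpa using hrα
  have hs0 : rxPower α u (x k) (g k) ≠ 0 := by
    rw [rxPower, hpow]
    exact mul_ne_zero hg0 (ENNReal.inv_ne_zero.2 ENNReal.ofReal_ne_top)
  have hst : rxPower α u (x k) (g k) ≠ ∞ := by
    rw [rxPower, hpow]
    exact ENNReal.mul_ne_top hgt (ENNReal.inv_ne_top.2 hq0)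
  rw [sinr, ENNReal.le_div_iff_mul_le (Or.inr hs0) (Or.inr hst), rxPower, hpow, ← div_eq_mul_inv,
    ENNReal.le_div_iff_mul_le (Or.inl hq0) (Or.inl ENNReal.ofReal_ne_top)]
  have hI : ENNReal.ofReal T * interference α u C x g k * ENNReal.ofReal (r ^ α) =
      ∑' n, ENNReal.ofReal ({n | n ≠ k ∧ x n ∉ C}.indicator
          (fun n => T * (r / dist (x n) u) ^ α) n) * ‖g n‖ₑ ^ 2 := by
    rw [interference, ← ENNReal.tsum_mul_left, ← ENNReal.tsum_mul_right]
    congr with n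
    by_cases hn : n ∈ {n | n ≠ k ∧ x n ∉ C}
    · rw [Set.indicator_of_mem hn, Set.indicator_of_mem hn, rxPower, edist_dist,
        ENNReal.ofReal_rpow_of_pos (hpos n), mul_left_comm, mul_comm, mul_left_comm,
        ← ENNReal.ofReal_mul (by positivity), ← ENNReal.ofReal_mul (by positivity), mul_comm]
      congr 2
      rw [Real.div_rpow hr.le (hpos n).le, Real.rpow_neg (hpos n).le]
      ring
    · rw [Set.indicator_of_notMem hn, Set.indicator_of_notMem hn]
      simp
  rw [mul_add, add_mul, hI, ← ENNReal.ofReal_mul hT.le, ← ENNReal.ofReal_mul (by positivity)]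

variable {Ω : Type*} [MeasurableSpace Ω] {P : Measure Ω} {lam : ℝ} {X : ℕ → Ω → Plane}
  {h : ℕ → Ω → ℂ}

lemma ae_fading_ne_zero
    (hlaw : ∀ n, HasLaw (h n) stdComplexGaussian P) (k : ℕ) : ∀ᵐ ω ∂P, h k ω ≠ 0 := by
  have h1 : ∀ᵐ z ∂stdComplexGaussian, z ≠ 0 := by
    have h2 := lintegral_norm_stdComplexGaussian (f := ({0} : Set ℝ).indicator 1)
      (measurable_one.indicator (measurableSet_singleton 0))
    have h3 : ∫⁻ r in Set.Ioi (0 : ℝ), ENNReal.ofReal (2 * r * Real.exp (-1 * r ^ 2)) *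
        ({0} : Set ℝ).indicator 1 r = 0 := by
      rw [setLIntegral_congr_fun (g := 0) measurableSet_Ioi]
      · simp
      · intro r hr
        have : r ≠ 0 := ne_of_gt hr
        simp [this]
    rw [h3] at h2
    rw [ae_iff]
    simp only [not_not, Set.ofPred_eq_eq_singleton]
    rw [← lintegral_indicator_one (measurableSet_singleton 0), ← h2]
    congr with z
    simp [Set.indicator]
  rw [← (hlaw k).map_eq] at h1
  exact ae_of_ae_map (hlaw k).aemeasurable h1

/-- Coverage probability for a fixed configuration of the stations. -/
lemma measure_covered_of_isNearest [IsProbabilityMeasure P]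
    (hh : ∀ n, Measurable (h n)) (hlaw : ∀ n, HasLaw (h n) stdComplexGaussian P)
    (hind : iIndepFun h P) {α σ T : ℝ} (hT : 0 < T) {u : Plane} {C : Set Plane}
    {x : ℕ → Plane} {k : ℕ} (hpos : ∀ n, 0 < dist (x n) u) (hk : IsNearest u x k) :
    P {ω | ∃ k, IsNearest u x k ∧ ENNReal.ofReal T ≤ sinr α σ u C x (fun n => h n ω) k} =
      expNeg (ENNReal.ofReal (T * σ ^ 2 * dist (x k) u ^ α)) *
        expNeg (∑' n, extField (fun w => Real.log (1 + w)) α T C u (dist (x k) u)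
          (dist (x k) u) (x n)) := by
  set w : ℕ → ℝ := {n | n ≠ k ∧ x n ∉ C}.indicator
    (fun n => T * (dist (x k) u / dist (x n) u) ^ α) with hw_def
  have hw : ∀ n, 0 ≤ w n := fun n => Set.indicator_nonneg (fun n _ => by positivity) n
  have hwk : w k = 0 := Set.indicator_of_notMem (by simp) _
  have huniq : ∀ j, IsNearest u x j → j = k := by
    intro j hj
    by_contra hjk
    exact lt_asymm (hj k (Ne.symm hjk)) (hk j hjk)
  -- The strict cut-off at the nearest distance discards exactly the serving station, since all
  -- others are strictly farther. The label `k` thus disappears from the sum.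
  have hsum : ∀ n, ENNReal.ofReal (Real.log (1 + w n)) =
      extField (fun w => Real.log (1 + w)) α T C u (dist (x k) u) (dist (x k) u) (x n) := by
    intro n
    by_cases hn : n ≠ k ∧ x n ∉ C
    · have h2 : x n ∈ {z | z ∉ C ∧ dist (x k) u < dist z u} := ⟨hn.2, hk n hn.1⟩
      have h3 : n ∈ {n | n ≠ k ∧ x n ∉ C} := hn
      rw [extField, Set.indicator_of_mem h2, hw_def, Set.indicator_of_mem h3]
    · have h2 : x n ∉ {z | z ∉ C ∧ dist (x k) u < dist z u} := by
        rintro ⟨h4, h5⟩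
        refine hn ⟨?_, h4⟩
        rintro rfl
        exact lt_irrefl _ h5
      have h3 : n ∉ {n | n ≠ k ∧ x n ∉ C} := hn
      rw [extField, Set.indicator_of_notMem h2, hw_def, Set.indicator_of_notMem h3]
      simp
  rw [← expNeg_add, ← tsum_congr hsum,
    ← measure_add_tsum_le_fading hh hlaw hind k _ hw hwk]
  refine measure_congr ?_
  filter_upwards [ae_fading_ne_zero hlaw k] with ω hω
  refine propext ⟨?_, fun hc => ?_⟩
  · rintro ⟨j, hj, hc⟩
    obtain rfl := huniq j hj
    exact (sinr_ge_iff hT hpos hω).1 hc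
  · exact ⟨k, hk, (sinr_ge_iff hT hpos hω).2 hc⟩

/-- Stated on the product of the configuration and fading spaces, so that independence and Fubini
allow averaging over the fading first. -/
lemma measurableSet_covered (α σ T : ℝ) (u : Plane) {C : Set Plane} (hC : MeasurableSet C) :
    MeasurableSet {p : (ℕ → Plane) × (ℕ → ℂ) |
      ∃ k, IsNearest u p.1 k ∧ ENNReal.ofReal T ≤ sinr α σ u C p.1 p.2 k} := by
  have hx : ∀ n, Measurable fun p : (ℕ → Plane) × (ℕ → ℂ) => p.1 n := fun n => by fun_prop
  have hg : ∀ n, Measurable fun p : (ℕ → Plane) × (ℕ → ℂ) => p.2 n := fun n => by fun_prop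
  have hrx : ∀ n, Measurable fun p : (ℕ → Plane) × (ℕ → ℂ) => rxPower α u (p.1 n) (p.2 n) :=
    fun n => ((hg n).enorm.pow_const 2).mul (((hx n).edist measurable_const).pow_const _)
  have hI : ∀ k, Measurable fun p : (ℕ → Plane) × (ℕ → ℂ) => interference α u C p.1 p.2 k := by
    intro k
    refine Measurable.tsum fun n => ?_
    by_cases hn : n = k
    · simp [hn]
    · have : (fun p : (ℕ → Plane) × (ℕ → ℂ) => {n | n ≠ k ∧ p.1 n ∉ C}.indicator
          (fun n => rxPower α u (p.1 n) (p.2 n)) n) =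
          {p : (ℕ → Plane) × (ℕ → ℂ) | p.1 n ∉ C}.indicator
            (fun p => rxPower α u (p.1 n) (p.2 n)) := by
        ext p
        by_cases hp : p.1 n ∈ C <;> simp [Set.indicator, hn, hp]
      rw [this]
      exact (hrx n).indicator (hx n hC.compl)
  simp only [Set.ofPred_exists, Set.ofPred_and]
  refine MeasurableSet.iUnion fun k => MeasurableSet.inter ?_
    (measurableSet_le measurable_const ((hrx k).div (measurable_const.add (hI k))))
  simp only [IsNearest, Set.ofPred_forall]
  exact MeasurableSet.iInter fun n => MeasurableSet.iInter fun _ =>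
    measurableSet_lt ((hx k).dist measurable_const) ((hx n).dist measurable_const)

/-- Coverage probability after averaging over the fading. -/
lemma coverage_eq_toReal_lintegral [IsProbabilityMeasure P] (hX : IsPoissonProcess P lam X)
    (hh : ∀ n, Measurable (h n)) (hlaw : ∀ n, HasLaw (h n) stdComplexGaussian P)
    (hind : iIndepFun h P) (hXh : IndepFun (fun ω n => X n ω) (fun ω n => h n ω) P)
    {α σ T : ℝ} (hT : 0 < T) (u : Plane) {C : Set Plane} (hC : MeasurableSet C) :
    coverage P α σ T X h C u = (∫⁻ ω,
      expNeg (ENNReal.ofReal (T * σ ^ 2 * distToNearest X u ω ^ α)) *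
        expNeg (∑' n, extField (fun w => Real.log (1 + w)) α T C u (distToNearest X u ω)
          (distToNearest X u ω) (X n ω)) ∂P).toReal := by
  set E := {p : (ℕ → Plane) × (ℕ → ℂ) |
      ∃ k, IsNearest u p.1 k ∧ ENNReal.ofReal T ≤ sinr α σ u C p.1 p.2 k} with hE_def
  have hE : MeasurableSet E := measurableSet_covered α σ T u hC
  have hXm : Measurable fun ω n => X n ω := measurable_pi_lambda _ hX.measurable
  have hhm : Measurable fun ω n => h n ω := measurable_pi_lambda _ hh
  have h1 : P {ω | ∃ k, IsNearest u (fun n => X n ω) k ∧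
      ENNReal.ofReal T ≤ sinr α σ u C (fun n => X n ω) (fun n => h n ω) k} =
      P.map (fun ω => ((fun n => X n ω), (fun n => h n ω))) E := by
    rw [Measure.map_apply (hXm.prodMk hhm) hE]; rfl
  rw [coverage, measureReal_def, h1,
    hXh.map_prod_eq_prod_map_map hXm.aemeasurable hhm.aemeasurable, Measure.prod_apply hE,
    lintegral_map (measurable_measure_prodMk_left hE) hXm]
  congr 1
  refine lintegral_congr_ae ?_
  filter_upwards [hX.ae_exists_isNearest u,
    hX.ae_notMem_of_volume_eq_zero (measurableSet_singleton u) (by simp)] with ω ⟨k, hk⟩ h0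
  rw [hk.distToNearest_eq, ← measure_covered_of_isNearest hh hlaw hind hT
    (fun n => dist_pos.2 (h0 n)) hk, Measure.map_apply hhm (measurable_prodMk_left hE)]
  rfl

end

/-! ### Averaging over the stations beyond the nearest one. -/

section

/-- After a translation, compare with `(1 + ‖z‖)^(-α)`, which is integrable because `α` exceeds the
dimension 2. -/
lemma lintegral_rpow_neg_dist_lt_top {α : ℝ} (hα : 2 < α) (u : Plane) {t : ℝ} (ht : 0 < t) :
    ∫⁻ z in {z | t < dist z u}, ENNReal.ofReal (dist z u ^ (-α)) < ∞ := by
  have hms : MeasurableSet {z : Plane | t < ‖z‖} := measurableSet_lt measurable_const measurable_norm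
  have h1 : ∫⁻ z in {z | t < dist z u}, ENNReal.ofReal (dist z u ^ (-α)) =
      ∫⁻ z in {z : Plane | t < ‖z‖}, ENNReal.ofReal (‖z‖ ^ (-α)) := by
    have hmu : MeasurableSet {z : Plane | t < dist z u} :=
      measurableSet_lt measurable_const (measurable_id.dist measurable_const)
    rw [← lintegral_indicator hms, ← lintegral_indicator hmu,
      ← lintegral_sub_right_eq_self ({z : Plane | t < ‖z‖}.indicator _) u]
    simp [dist_eq_norm, Set.indicator]
  -- The constant comes from `1 + ‖z‖ ≤ ((1 + t)/t) ‖z‖` when `‖z‖ > t`.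
  have h2 : ∀ z ∈ {z : Plane | t < ‖z‖}, ENNReal.ofReal (‖z‖ ^ (-α)) ≤
      ENNReal.ofReal (((1 + t) / t) ^ α) * ENNReal.ofReal ((1 + ‖z‖) ^ (-α)) := by
    intro z hz
    have hz' : t < ‖z‖ := hz
    have hz0 : 0 < ‖z‖ := ht.trans hz'
    rw [← ENNReal.ofReal_mul (by positivity)]
    apply ENNReal.ofReal_le_ofReal
    have h3 : ((1 + t) / t) ^ α * (1 + ‖z‖) ^ (-α) = ((1 + t) / t / (1 + ‖z‖)) ^ α := by
      rw [Real.div_rpow (x := (1 + t) / t) (by positivity) (by positivity),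
        Real.div_rpow (by positivity) (by positivity),
        Real.rpow_neg (by positivity), div_eq_mul_inv (_ / _)]
    have h4 : ‖z‖ ^ (-α) = (1 / ‖z‖) ^ α := by
      rw [Real.rpow_neg hz0.le, one_div, Real.inv_rpow hz0.le]
    rw [h3, h4]
    refine Real.rpow_le_rpow (by positivity) ?_ (by linarith)
    rw [div_div, div_le_div_iff₀ hz0 (by positivity)]
    nlinarith
  rw [h1]
  calc _ ≤ ∫⁻ z in {z : Plane | t < ‖z‖},
        ENNReal.ofReal (((1 + t) / t) ^ α) * ENNReal.ofReal ((1 + ‖z‖) ^ (-α)) :=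
        setLIntegral_mono' hms h2
    _ ≤ ∫⁻ z : Plane, ENNReal.ofReal (((1 + t) / t) ^ α) * ENNReal.ofReal ((1 + ‖z‖) ^ (-α)) :=
        setLIntegral_le_lintegral _ _
    _ < ∞ := by
        rw [lintegral_const_mul _ (by fun_prop)]
        exact ENNReal.mul_lt_top ENNReal.ofReal_lt_top
          (finite_integral_one_add_norm (by simpa using hα))

/-- A common majorant for dominated convergence; `G w ≤ w` covers both `log(1 + w)` and `w/(1 + w)`.
-/
lemma extField_le {G : ℝ → ℝ} (hGle : ∀ w, 0 ≤ w → G w ≤ w) {α T : ℝ} (hα : 0 < α) (hT : 0 < T)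
    (C : Set Plane) (u : Plane) {s t s₀ t₀ : ℝ} (hs : 0 ≤ s) (hs₀ : s ≤ s₀) (ht : t₀ ≤ t)
    (ht₀ : 0 ≤ t₀) (z : Plane) :
    extField G α T C u s t z ≤ {z | z ∉ C ∧ t₀ < dist z u}.indicator
      (fun z => ENNReal.ofReal (T * s₀ ^ α) * ENNReal.ofReal (dist z u ^ (-α))) z := by
  by_cases hz : z ∈ {z | z ∉ C ∧ t < dist z u}
  · have hz₀ : z ∈ {z | z ∉ C ∧ t₀ < dist z u} := ⟨hz.1, ht.trans_lt hz.2⟩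
    have hd : 0 < dist z u := ht₀.trans_lt hz₀.2
    rw [extField, Set.indicator_of_mem hz, Set.indicator_of_mem hz₀,
      ← ENNReal.ofReal_mul (by have := hs.trans hs₀; positivity)]
    apply ENNReal.ofReal_le_ofReal
    calc G (T * (s / dist z u) ^ α) ≤ T * (s / dist z u) ^ α := hGle _ (by positivity)
      _ ≤ T * (s₀ / dist z u) ^ α := by gcongr
      _ = T * s₀ ^ α * dist z u ^ (-α) := by
        rw [Real.div_rpow (hs.trans hs₀) hd.le, Real.rpow_neg hd.le]; ring
  · rw [extField, Set.indicator_of_notMem hz]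
    exact zero_le

/-- Continuity of the interference along thresholds decreasing to the limit. -/
lemma tendsto_lintegral_extField {μ : Measure Plane} {G : ℝ → ℝ} (hG : Measurable G)
    (hGc : ContinuousOn G (Set.Ici 0)) (hGle : ∀ w, 0 ≤ w → G w ≤ w) {α T : ℝ} (hα : 0 < α)
    (hT : 0 < T) {C : Set Plane} (hC : MeasurableSet C) {u : Plane} {s₀ : ℝ} (hs₀ : 0 < s₀)
    (hμ : ∫⁻ z in {z | s₀ < dist z u}, ENNReal.ofReal (dist z u ^ (-α)) ∂μ ≠ ∞)
    {s t : ℕ → ℝ} (hs : ∀ m, 0 ≤ s m) (hs' : ∀ m, s m ≤ s₀) (hslim : Tendsto s atTop (𝓝 s₀))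
    (ht : ∀ m, s₀ ≤ t m) (htlim : Tendsto t atTop (𝓝 s₀)) :
    Tendsto (fun m => ∫⁻ z, extField G α T C u (s m) (t m) z ∂μ) atTop
      (𝓝 (∫⁻ z, extField G α T C u s₀ s₀ z ∂μ)) := by
  refine tendsto_lintegral_of_dominated_convergence _
    (fun m => measurable_extField hG α T hC u _ _)
    (fun m => .of_forall (extField_le hGle hα hT C u (hs m) (hs' m) (ht m) hs₀.le)) ?_
    (.of_forall fun z => ?_)
  · refine ne_top_of_le_ne_top (ENNReal.mul_ne_top (ENNReal.ofReal_ne_top (r := T * s₀ ^ α)) hμ) ?_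
    have hm : MeasurableSet {z | s₀ < dist z u} :=
      measurableSet_lt measurable_const (measurable_id.dist measurable_const)
    rw [← lintegral_const_mul _ (by fun_prop), ← lintegral_indicator hm]
    refine lintegral_mono fun z => ?_
    exact Set.indicator_le_indicator_of_subset (fun z hz => hz.2) (fun _ => zero_le) z
  · by_cases hz : z ∈ {z | z ∉ C ∧ s₀ < dist z u}
    · have hd : 0 < dist z u := hs₀.trans hz.2
      rw [extField, Set.indicator_of_mem hz]
      have hlim : Tendsto (fun m => T * (s m / dist z u) ^ α) atTop
          (𝓝[Set.Ici 0] (T * (s₀ / dist z u) ^ α)) := by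
        refine tendsto_nhdsWithin_iff.2 ⟨?_, .of_forall fun m => ?_⟩
        · exact ((hslim.div_const _).rpow_const (Or.inr hα.le)).const_mul T
        · have := hs m
          exact Set.mem_Ici.2 (by positivity)
      have h2 := (ENNReal.continuous_ofReal.tendsto _).comp
        ((hGc (T * (s₀ / dist z u) ^ α) (Set.mem_Ici.2 (by positivity))).tendsto.comp hlim)
      refine h2.congr' ?_
      filter_upwards [htlim.eventually (gt_mem_nhds hz.2)] with m hm
      have hz' : z ∈ {z | z ∉ C ∧ t m < dist z u} := ⟨hz.1, hm⟩
      rw [extField, Set.indicator_of_mem hz']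
      rfl
    -- Here `t m ≥ s₀` is essential: convergence must hold also on the sphere of radius `s₀`, which
    -- the counting measure charges when `s₀` is the nearest distance.
    · rw [extField, Set.indicator_of_notMem hz]
      refine tendsto_const_nhds.congr fun m => ?_
      rw [extField, Set.indicator_of_notMem]
      exact fun h => hz ⟨h.1, (ht m).trans_lt h.2⟩

/-- The identity `1 - 1/(1 + w) = w/(1 + w)`: the Laplace functional replaces the field of `log(1 +
w)` by that of `w/(1 + w)`. -/
lemma one_sub_expNeg_extField_log {α T : ℝ} (hT : 0 < T) (C : Set Plane) (u : Plane) {s : ℝ}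
    (hs : 0 ≤ s) (t : ℝ) (z : Plane) :
    1 - expNeg (extField (fun w => Real.log (1 + w)) α T C u s t z) =
      extField (fun w => w / (1 + w)) α T C u s t z := by
  by_cases hz : z ∈ {z | z ∉ C ∧ t < dist z u}
  · rw [extField, extField, Set.indicator_of_mem hz, Set.indicator_of_mem hz]
    have hw : 0 ≤ T * (s / dist z u) ^ α := by positivity
    set w := T * (s / dist z u) ^ α
    rw [expNeg_ofReal (Real.log_nonneg (by linarith)), Real.exp_neg, Real.exp_log (by linarith),
      ← ENNReal.ofReal_one, ← ENNReal.ofReal_sub _ (by positivity)]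
    congr 1
    field_simp
    ring
  · rw [extField, extField, Set.indicator_of_notMem hz, Set.indicator_of_notMem hz, expNeg_zero,
      tsub_self]

variable {Ω : Type*} [MeasurableSpace Ω] {P : Measure Ω} {lam : ℝ} {X : ℕ → Ω → Plane}
  {h : ℕ → Ω → ℂ}

/-- Campbell's formula handles the thresholds `1/(k + 1)`, and monotonicity the rest. One null set
must serve all `t`, because the threshold used later is the random nearest distance. -/
lemma IsPoissonProcess.ae_setLIntegral_rpow_lt_top [IsProbabilityMeasure P]
    (hX : IsPoissonProcess P lam X) {α : ℝ} (hα : 2 < α) (u : Plane) :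
    ∀ᵐ ω ∂P, ∀ t > 0, ∫⁻ z in {z | t < dist z u}, ENNReal.ofReal (dist z u ^ (-α))
      ∂(pointMeasure fun n => X n ω) < ∞ := by
  have hm : ∀ t, MeasurableSet {z : Plane | t < dist z u} := fun t =>
    measurableSet_lt measurable_const (measurable_id.dist measurable_const)
  have h1 : ∀ᵐ ω ∂P, ∀ k : ℕ, ∫⁻ z in {z | 1 / ((k : ℝ) + 1) < dist z u},
      ENNReal.ofReal (dist z u ^ (-α)) ∂(pointMeasure fun n => X n ω) < ∞ := by
    rw [ae_all_iff]
    intro k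
    have hf : Measurable ({z | 1 / ((k : ℝ) + 1) < dist z u}.indicator
        fun z => ENNReal.ofReal (dist z u ^ (-α))) :=
      Measurable.indicator (by fun_prop) (hm _)
    simp_rw [← lintegral_indicator (hm _), lintegral_pointMeasure]
    refine ae_lt_top (hX.measurable_tsum hf) ?_
    rw [hX.lintegral_tsum hf, lintegral_indicator (hm _)]
    exact ENNReal.mul_ne_top ENNReal.ofReal_ne_top
      (lintegral_rpow_neg_dist_lt_top hα u (by positivity)).ne
  filter_upwards [h1] with ω hω t ht
  obtain ⟨k, hk⟩ := exists_nat_one_div_lt ht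
  exact (lintegral_mono_set fun z hz => hk.trans hz).trans_lt (hω k)

/-- Partitioning by the value of the random index reduces the equality to one deterministic index at
a time. -/
lemma lintegral_comp_nat_eq {H K : ℕ → Ω → ℝ≥0∞} {j : Ω → ℕ} (hj : Measurable j)
    (hHK : ∀ i, ∫⁻ ω in j ⁻¹' {i}, H i ω ∂P = ∫⁻ ω in j ⁻¹' {i}, K i ω ∂P) :
    ∫⁻ ω, H (j ω) ω ∂P = ∫⁻ ω, K (j ω) ω ∂P := by
  have hm : ∀ i, MeasurableSet (j ⁻¹' {i}) := fun i => hj (measurableSet_singleton i)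
  have key : ∀ F : ℕ → Ω → ℝ≥0∞, ∫⁻ ω, F (j ω) ω ∂P = ∑' i, ∫⁻ ω in j ⁻¹' {i}, F i ω ∂P := by
    intro F
    have hU : ⋃ i, j ⁻¹' {i} = Set.univ := by ext ω; simp
    rw [← setLIntegral_univ, ← hU, lintegral_iUnion hm
      fun i k hik => Disjoint.preimage _ (Set.disjoint_singleton.2 hik)]
    congr with i
    refine setLIntegral_congr_fun (hm i) fun ω hω => ?_
    rw [Set.mem_preimage, Set.mem_singleton_iff] at hω
    simp only [hω]
  rw [key, key]
  exact tsum_congr hHK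

/-- The configuration outside a disc is independent of the event that the nearest station is at a
distance in a given interval. -/
lemma IsPoissonProcess.setLIntegral_distToNearest_mem_Ico [IsProbabilityMeasure P]
    (hX : IsPoissonProcess P lam X) (u : Plane) {a b : ℝ} (hab : a ≤ b) {f : Plane → ℝ≥0∞}
    (hf : Measurable f) (hfb : ∀ z ∈ Metric.ball u b, f z = 0) :
    ∫⁻ ω in distToNearest X u ⁻¹' Set.Ico a b, expNeg (∑' n, f (X n ω)) ∂P =
      P (distToNearest X u ⁻¹' Set.Ico a b) *
        expNeg (ENNReal.ofReal lam * ∫⁻ z, (1 - expNeg (f z))) := by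
  have hm : ∀ t, MeasurableSet {ω | t ≤ distToNearest X u ω} := fun t =>
    measurableSet_le measurable_const (hX.measurable_distToNearest u)
  -- The event is that the ball of radius `t` is void, and `f` vanishes there. The interval is then
  -- handled by subtracting the case `t = b` from `t = a`.
  have hV : ∀ t ≤ b, ∫⁻ ω in {ω | t ≤ distToNearest X u ω}, expNeg (∑' n, f (X n ω)) ∂P =
      P {ω | t ≤ distToNearest X u ω} *
        expNeg (ENNReal.ofReal lam * ∫⁻ z, (1 - expNeg (f z))) := by
    intro t ht
    rw [hX.measure_le_distToNearest]
    simp_rw [le_distToNearest_iff]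
    exact hX.setLIntegral_void measurableSet_ball hf
      fun z hz => hfb z (Metric.ball_subset_ball ht hz)
  have hdiff : distToNearest X u ⁻¹' Set.Ico a b =
      {ω | a ≤ distToNearest X u ω} \ {ω | b ≤ distToNearest X u ω} := by
    ext ω
    simp
  have hinter : {ω | a ≤ distToNearest X u ω} ∩ {ω | b ≤ distToNearest X u ω} =
      {ω | b ≤ distToNearest X u ω} :=
    Set.inter_eq_right.2 fun ω hω => hab.trans hω
  have h1 := lintegral_inter_add_sdiff (μ := P) (fun ω => expNeg (∑' n, f (X n ω)))
    {ω | a ≤ distToNearest X u ω} (hm b)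
  have h2 := measure_inter_add_sdiff (μ := P) {ω | a ≤ distToNearest X u ω} (hm b)
  rw [hinter] at h1 h2
  rw [hV a hab, hV b le_rfl, ← h2, add_mul, ← hdiff] at h1
  exact (ENNReal.add_right_inj (ENNReal.mul_ne_top (measure_ne_top _ _) (expNeg_ne_top _))).1 h1

/-- Averaging over the configuration of a functional of the nearest distance and of the field of
the stations beyond it. -/
theorem IsPoissonProcess.lintegral_expNeg_extField [IsProbabilityMeasure P]
    (hX : IsPoissonProcess P lam X) {α T : ℝ} (hα : 2 < α) (hT : 0 < T) (u : Plane)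
    {C : Set Plane} (hC : MeasurableSet C) {a : ℝ → ℝ≥0∞} (ha : Continuous a) :
    ∫⁻ ω, expNeg (a (distToNearest X u ω)) *
        expNeg (∑' n, extField (fun w => Real.log (1 + w)) α T C u (distToNearest X u ω)
          (distToNearest X u ω) (X n ω)) ∂P =
      ∫⁻ ω, expNeg (a (distToNearest X u ω)) *
        expNeg (ENNReal.ofReal lam * ∫⁻ z, extField (fun w => w / (1 + w)) α T C u
          (distToNearest X u ω) (distToNearest X u ω) z) ∂P := by
  have hlogm : Measurable fun w : ℝ => Real.log (1 + w) := by fun_prop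
  have hlogc : ContinuousOn (fun w : ℝ => Real.log (1 + w)) (Set.Ici 0) := by
    refine ContinuousOn.log (by fun_prop) fun w hw => ?_
    have : (0 : ℝ) ≤ w := hw
    positivity
  have hlogle : ∀ w : ℝ, 0 ≤ w → Real.log (1 + w) ≤ w := fun w hw => by
    linarith [Real.log_le_sub_one_of_pos (show 0 < 1 + w by linarith)]
  have hdivm : Measurable fun w : ℝ => w / (1 + w) := by fun_prop
  have hdivc : ContinuousOn (fun w : ℝ => w / (1 + w)) (Set.Ici 0) := by
    refine ContinuousOn.div (by fun_prop) (by fun_prop) fun w hw => ?_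
    have : (0 : ℝ) ≤ w := hw
    positivity
  have hdivle : ∀ w : ℝ, 0 ≤ w → w / (1 + w) ≤ w := fun w hw => div_le_self hw (by linarith)
  let r := distToNearest X u
  have hr0 : ∀ ω, 0 ≤ r ω := distToNearest_nonneg u
  have hrm : Measurable r := hX.measurable_distToNearest u
  -- Mesh `1/(m + 1)`. On each cell the weight uses the lower endpoint and the cut-off the upper
  -- one. The field is then deterministic and vanishes up to the end of the cell, as the
  -- independence statement requires.
  let lo : ℕ → ℕ → ℝ := fun m i => i / ((m : ℝ) + 1)
  let j : ℕ → Ω → ℕ := fun m ω => ⌊((m : ℝ) + 1) * r ω⌋₊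
  have hj : ∀ m, Measurable (j m) := fun m => Nat.measurable_floor.comp (hrm.const_mul _)
  have hpre : ∀ m i, j m ⁻¹' {i} = r ⁻¹' Set.Ico (lo m i) (lo m (i + 1)) := by
    intro m i
    ext ω
    have hm : (0 : ℝ) < m + 1 := by positivity
    rw [Set.mem_preimage, Set.mem_singleton_iff, Set.mem_preimage, Set.mem_Ico,
      Nat.floor_eq_iff (mul_nonneg hm.le (hr0 ω)), div_le_iff₀ hm, lt_div_iff₀ hm]
    push_cast
    rw [mul_comm (r ω)]
  let H : ℕ → ℕ → Ω → ℝ≥0∞ := fun m i ω => expNeg (a (lo m i)) * expNeg (∑' n,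
    extField (fun w => Real.log (1 + w)) α T C u (lo m i) (lo m (i + 1)) (X n ω))
  let K : ℕ → ℕ → Ω → ℝ≥0∞ := fun m i _ => expNeg (a (lo m i)) * expNeg (ENNReal.ofReal lam *
    ∫⁻ z, extField (fun w => w / (1 + w)) α T C u (lo m i) (lo m (i + 1)) z)
  have hHm : ∀ m i, Measurable (H m i) := fun m i => (measurable_expNeg.comp
    (hX.measurable_tsum (measurable_extField hlogm α T hC u _ _))).const_mul _
  have hKm : ∀ m i, Measurable (K m i) := fun m i => measurable_const
  have hloi : ∀ m i, 0 ≤ lo m i := fun m i => by positivity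
  have hle : ∀ m i, lo m i ≤ lo m (i + 1) := fun m i => by
    simp only [lo]; gcongr; simp
  have hHK : ∀ m, ∫⁻ ω, H m (j m ω) ω ∂P = ∫⁻ ω, K m (j m ω) ω ∂P := by
    intro m
    refine lintegral_comp_nat_eq (hj m) fun i => ?_
    simp only [H, K]
    rw [lintegral_const_mul _ (measurable_expNeg.fun_comp
      (hX.measurable_tsum (measurable_extField hlogm α T hC u _ _))), hpre,
      hX.setLIntegral_distToNearest_mem_Ico u (hle m i)
        (measurable_extField hlogm α T hC u _ _) (fun z hz => ?_), lintegral_const,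
      Measure.restrict_apply_univ, mul_comm (P _), mul_assoc]
    · simp_rw [one_sub_expNeg_extField_log hT C u (hloi m i)]
      rfl
    · rw [extField, Set.indicator_of_notMem]
      exact fun hz' => lt_asymm hz'.2 (Metric.mem_ball.1 hz)
  have hlolim : ∀ ω, Tendsto (fun m => lo m (j m ω)) atTop (𝓝 (r ω)) ∧
      Tendsto (fun m => lo m (j m ω + 1)) atTop (𝓝 (r ω)) ∧
      (∀ m, lo m (j m ω) ≤ r ω) ∧ ∀ m, r ω ≤ lo m (j m ω + 1) := by
    intro ω
    have hmem : ∀ m, r ω ∈ Set.Ico (lo m (j m ω)) (lo m (j m ω + 1)) := fun m => by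
      have : ω ∈ j m ⁻¹' {j m ω} := rfl
      rwa [hpre] at this
    have hdiff : ∀ m i, lo m (i + 1) = lo m i + 1 / ((m : ℝ) + 1) := fun m i => by
      simp only [lo]; push_cast; ring
    have hz := tendsto_one_div_add_atTop_nhds_zero_nat (𝕜 := ℝ)
    refine ⟨?_, ?_, fun m => (hmem m).1, fun m => (hmem m).2.le⟩
    · refine tendsto_of_tendsto_of_tendsto_of_le_of_le (g := fun m : ℕ => r ω - 1 / ((m : ℝ) + 1))
        (h := fun _ => r ω) (by simpa using hz.const_sub (r ω)) tendsto_const_nhds (fun m => ?_)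
        fun m => (hmem m).1
      have := (hmem m).2
      rw [hdiff] at this
      simp only
      linarith
    · refine tendsto_of_tendsto_of_tendsto_of_le_of_le (g := fun _ => r ω)
        (h := fun m : ℕ => r ω + 1 / ((m : ℝ) + 1)) tendsto_const_nhds
        (by simpa using hz.const_add (r ω)) (fun m => (hmem m).2.le) fun m => ?_
      have := (hmem m).1
      simp only
      rw [hdiff]
      linarith
  have halim : ∀ ω, Tendsto (fun m => expNeg (a (lo m (j m ω)))) atTop (𝓝 (expNeg (a (r ω)))) :=
    fun ω => ((continuous_expNeg.comp ha).tendsto _).comp (hlolim ω).1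
  have hmulexp : ∀ {F G : ℕ → ℝ≥0∞} {x y : ℝ≥0∞},
      Tendsto (fun m => expNeg (F m)) atTop (𝓝 (expNeg x)) → Tendsto G atTop (𝓝 y) →
      Tendsto (fun m => expNeg (F m) * expNeg (G m)) atTop (𝓝 (expNeg x * expNeg y)) := by
    intro F G x y hF hG
    exact ENNReal.Tendsto.mul hF (Or.inr (expNeg_ne_top _))
      ((continuous_expNeg.tendsto _).comp hG) (Or.inr (expNeg_ne_top _))
  have hmeas : ∀ F : ℕ → Ω → ℝ≥0∞, (∀ i, Measurable (F i)) → ∀ m,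
      Measurable fun ω => F (j m ω) ω := fun F hF m =>
    (measurable_from_prod_countable_right hF : Measurable fun p : ℕ × Ω => F p.1 p.2).comp
      ((hj m).prodMk measurable_id)
  have hbound : ∀ x y : ℝ≥0∞, expNeg x * expNeg y ≤ 1 := fun x y =>
    mul_le_one' (expNeg_le_one _) (expNeg_le_one _)
  -- The two sides are limits of the same discretised sequence, read once through `H` and once
  -- through `K`.
  refine tendsto_nhds_unique (f := fun m => ∫⁻ ω, H m (j m ω) ω ∂P) (l := atTop) ?_ ?_
  · refine tendsto_lintegral_of_dominated_convergence (fun _ => 1)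
      (fun m => hmeas (H m) (hHm m) m) (fun m => .of_forall fun ω => hbound _ _) (by simp) ?_
    filter_upwards [hX.ae_distToNearest_pos u, hX.ae_setLIntegral_rpow_lt_top hα u] with ω hω hfin
    refine hmulexp (halim ω) ?_
    simp_rw [← lintegral_pointMeasure (fun n => X n ω)]
    exact tendsto_lintegral_extField hlogm hlogc hlogle (by linarith) hT hC hω (hfin _ hω).ne
      (fun m => hloi _ _) (hlolim ω).2.2.1 (hlolim ω).1 (hlolim ω).2.2.2 (hlolim ω).2.1
  · simp_rw [hHK]
    refine tendsto_lintegral_of_dominated_convergence (fun _ => 1)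
      (fun m => hmeas (K m) (hKm m) m) (fun m => .of_forall fun ω => hbound _ _) (by simp) ?_
    filter_upwards [hX.ae_distToNearest_pos u] with ω hω
    refine hmulexp (halim ω) (ENNReal.Tendsto.const_mul ?_ (Or.inr ENNReal.ofReal_ne_top))
    exact tendsto_lintegral_extField hdivm hdivc hdivle (by linarith) hT hC hω
      (lintegral_rpow_neg_dist_lt_top hα u hω).ne
      (fun m => hloi _ _) (hlolim ω).2.2.1 (hlolim ω).1 (hlolim ω).2.2.2 (hlolim ω).2.1

end

/-! ### Scaling and small-argument behaviour of the exterior mass. -/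

section

lemma measurable_lintegral_extField {G : ℝ → ℝ} (hG : Measurable G) (α T : ℝ) {C : Set Plane}
    (hC : MeasurableSet C) (u : Plane) :
    Measurable fun s => ∫⁻ z, extField G α T C u s s z := by
  have hm : MeasurableSet {p : ℝ × Plane | p.2 ∉ C ∧ p.1 < dist p.2 u} :=
    (measurable_snd hC.compl).inter
      (measurableSet_lt measurable_fst (measurable_snd.dist measurable_const))
  have h1 : Measurable ({p : ℝ × Plane | p.2 ∉ C ∧ p.1 < dist p.2 u}.indicator
      fun p => ENNReal.ofReal (G (T * (p.1 / dist p.2 u) ^ α))) :=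
    Measurable.indicator (by fun_prop) hm
  exact h1.lintegral_prod_right'

variable {Ω : Type*} [MeasurableSpace Ω] {P : Measure Ω} {lam : ℝ} {X : ℕ → Ω → Plane}
  {h : ℕ → Ω → ℂ}

lemma IsPoissonProcess.measurable_nearestDist (hX : IsPoissonProcess P lam X) :
    Measurable (nearestDist X) := hX.measurable_distToNearest 0

omit [MeasurableSpace Ω] in
lemma nearestDist_nonneg (ω : Ω) : 0 ≤ nearestDist X ω := distToNearest_nonneg 0 ω

lemma IsPoissonProcess.ae_nearestDist_pos [IsProbabilityMeasure P]
    (hX : IsPoissonProcess P lam X) : ∀ᵐ ω ∂P, 0 < nearestDist X ω := hX.ae_distToNearest_pos 0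

/-- Coverage probability as an average over the distance to the nearest station. -/
theorem coverage_eq_toReal_lintegral_nearestDist [IsProbabilityMeasure P]
    (hX : IsPoissonProcess P lam X)
    (hh : ∀ n, Measurable (h n)) (hlaw : ∀ n, HasLaw (h n) stdComplexGaussian P)
    (hind : iIndepFun h P) (hXh : IndepFun (fun ω n => X n ω) (fun ω n => h n ω) P)
    {α σ T : ℝ} (hα : 2 < α) (hT : 0 < T) (u : Plane) {C : Set Plane} (hC : MeasurableSet C) :
    coverage P α σ T X h C u = (∫⁻ ω,
      expNeg (ENNReal.ofReal (T * σ ^ 2 * nearestDist X ω ^ α)) *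
        expNeg (ENNReal.ofReal lam * ∫⁻ z, extField (fun w => w / (1 + w)) α T C u
          (nearestDist X ω) (nearestDist X ω) z) ∂P).toReal := by
  have ha : Continuous fun r : ℝ => ENNReal.ofReal (T * σ ^ 2 * r ^ α) :=
    ENNReal.continuous_ofReal.comp
      ((Real.continuous_rpow_const (by linarith)).const_mul _)
  let Ψ : ℝ → ℝ≥0∞ := fun r => expNeg (ENNReal.ofReal (T * σ ^ 2 * r ^ α)) *
    expNeg (ENNReal.ofReal lam * ∫⁻ z, extField (fun w => w / (1 + w)) α T C u r r z)
  have hΨ : Measurable Ψ := (measurable_expNeg.comp ha.measurable).mul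
    (measurable_expNeg.comp ((measurable_lintegral_extField (by fun_prop) α T hC u).const_mul _))
  rw [coverage_eq_toReal_lintegral hX hh hlaw hind hXh hT u hC,
    hX.lintegral_expNeg_extField hα hT u hC ha]
  change (∫⁻ ω, Ψ (distToNearest X u ω) ∂P).toReal = (∫⁻ ω, Ψ (nearestDist X ω) ∂P).toReal
  -- Only the law of the nearest distance enters now, so it may be measured from the origin.
  rw [← lintegral_map hΨ (hX.measurable_distToNearest u), hX.map_distToNearest u,
    lintegral_map hΨ hX.measurable_nearestDist]

/-- Area outside the unit disc, weighted by `1 - 1 / (1 + T (q / ‖z - (1 - δ, 0)‖)^α)` and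
restricted to the points farther than `q` from `(1 - δ, 0)`. -/
def exteriorMass (α T δ q : ℝ) : ℝ≥0∞ :=
  ∫⁻ z, extField (fun w => w / (1 + w)) α T (Metric.ball 0 1) !₂[1 - δ, 0] q q z

lemma userSite_eq_smul (δ R : ℝ) : (!₂[(1 - δ) * R, 0] : Plane) = R • !₂[1 - δ, 0] := by
  ext i
  fin_cases i <;> simp [mul_comm]

lemma lintegral_comp_smul_plane {f : Plane → ℝ≥0∞} (hf : Measurable f) {R : ℝ} (hR : 0 < R) :
    ∫⁻ z, f z = ENNReal.ofReal (R ^ 2) * ∫⁻ z, f (R • z) := by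
  have h1 := Measure.map_addHaar_smul (volume : Measure Plane) hR.ne'
  rw [← lintegral_map hf (measurable_const_smul R), h1, lintegral_smul_measure, smul_eq_mul,
    ← mul_assoc, ← ENNReal.ofReal_mul (by positivity), finrank_euclideanSpace_fin,
    abs_of_pos (by positivity), mul_inv_cancel₀ (by positivity), ENNReal.ofReal_one, one_mul]

/-- Substitute `R • z` for `z`. The disc and user become those of radius 1, the weight depends only
on the ratio of `s` to a distance, and the area scales by `R²`. -/
lemma lintegral_extField_scale (α T δ : ℝ) {R : ℝ} (hR : 0 < R) (s : ℝ) :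
    ∫⁻ z, extField (fun w => w / (1 + w)) α T (Metric.ball 0 R) !₂[(1 - δ) * R, 0] s s z =
      ENNReal.ofReal (R ^ 2) * exteriorMass α T δ (s / R) := by
  rw [lintegral_comp_smul_plane (measurable_extField (by fun_prop) α T measurableSet_ball _ _ _) hR,
    exteriorMass]
  congr 2
  ext z
  have hd : dist (R • z) (!₂[(1 - δ) * R, 0] : Plane) = R * dist z !₂[1 - δ, 0] := by
    rw [userSite_eq_smul, dist_smul₀, Real.norm_of_nonneg hR.le]
  have hmem : R • z ∈ {z : Plane | z ∉ Metric.ball 0 R ∧ s < dist z !₂[(1 - δ) * R, 0]} ↔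
      z ∈ {z : Plane | z ∉ Metric.ball 0 1 ∧ s / R < dist z !₂[1 - δ, 0]} := by
    simp only [Set.mem_ofPred_eq, hd, div_lt_iff₀' hR, Metric.mem_ball, dist_zero_right,
      norm_smul, Real.norm_of_nonneg hR.le, mul_lt_iff_lt_one_right hR]
  by_cases hz : z ∈ {z : Plane | z ∉ Metric.ball 0 1 ∧ s / R < dist z !₂[1 - δ, 0]}
  · rw [extField, extField, Set.indicator_of_mem hz, Set.indicator_of_mem (hmem.2 hz), hd,
      div_div]
  · rw [extField, extField, Set.indicator_of_notMem hz,
      Set.indicator_of_notMem (fun h => hz (hmem.1 h))]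

/-- The cooperating discs, seen from their users, are nested. -/
lemma lintegral_extField_cluster_antitone {α T δ : ℝ} (hδ : 0 < δ) (hδ' : δ ≤ 1)
    {R R' : ℝ} (hRR' : R ≤ R') (s : ℝ) :
    ∫⁻ z, extField (fun w => w / (1 + w)) α T (Metric.ball 0 R') !₂[(1 - δ) * R', 0] s s z ≤
      ∫⁻ z, extField (fun w => w / (1 + w)) α T (Metric.ball 0 R) !₂[(1 - δ) * R, 0] s s z := by
  rw [← lintegral_add_right_eq_self _ (!₂[(1 - δ) * R', 0] : Plane),
    ← lintegral_add_right_eq_self (extField _ α T (Metric.ball 0 R) _ s s)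
      (!₂[(1 - δ) * R, 0] : Plane)]
  refine lintegral_mono fun y => ?_
  simp only [extField, Set.indicator, Set.mem_ofPred_eq, dist_add_self_left, Metric.mem_ball,
    dist_zero_right, not_lt]
  by_cases h1 : R' ≤ ‖y + !₂[(1 - δ) * R', 0]‖ ∧ s < ‖y‖
  · have h2 : R ≤ ‖y + !₂[(1 - δ) * R, 0]‖ := by
      -- Seen from the user, the centre moves by `(1 - δ)(R' - R)`, no more than the growth of the
      -- radius, so the smaller disc stays inside.
      have h3 : ‖(!₂[(1 - δ) * R', 0] : Plane) - !₂[(1 - δ) * R, 0]‖ ≤ R' - R := by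
        rw [userSite_eq_smul, userSite_eq_smul, ← sub_smul, norm_smul,
          Real.norm_of_nonneg (by linarith), EuclideanSpace.norm_eq]
        have : √((1 - δ) ^ 2) ≤ 1 := by
          rw [Real.sqrt_sq (by linarith)]; linarith
        simpa using mul_le_mul_of_nonneg_left this (by linarith : 0 ≤ R' - R)
      have h4 := norm_add_le (y + !₂[(1 - δ) * R, 0])
        ((!₂[(1 - δ) * R', 0] : Plane) - !₂[(1 - δ) * R, 0])
      rw [add_assoc, add_sub_cancel] at h4
      linarith [h1.1]
    rw [if_pos h1, if_pos ⟨h2, h1.2⟩]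
  · rw [if_neg h1]
    exact zero_le

/-- The user is at depth `δ` inside the unit disc. This keeps the singularity of `‖z - u‖^(-α)` away
from the exterior and makes `Δ` finite. -/
lemma userSite_dist_ge {δ : ℝ} (hδ' : δ ≤ 1) {z : Plane} (hz : z ∉ Metric.ball (0 : Plane) 1) :
    δ ≤ dist z !₂[1 - δ, 0] := by
  have h1 : ‖(!₂[1 - δ, 0] : Plane)‖ = 1 - δ := by
    rw [EuclideanSpace.norm_eq]
    simp [Real.sqrt_sq_eq_abs, abs_of_nonneg (sub_nonneg.2 hδ')]
  have h2 : 1 ≤ ‖z‖ := by simpa using hz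
  have h3 := norm_sub_norm_le z !₂[1 - δ, 0]
  rw [dist_eq_norm]
  linarith

lemma integrableOn_rpow_neg_norm_sub {α δ : ℝ} (hα : 2 < α) (hδ : 0 < δ) (hδ' : δ ≤ 1) :
    IntegrableOn (fun z : Plane => ‖z - !₂[1 - δ, 0]‖ ^ (-α)) (Metric.ball (0 : Plane) 1)ᶜ := by
  refine ⟨Measurable.aestronglyMeasurable (by fun_prop), ?_⟩
  rw [hasFiniteIntegral_iff_ofReal (.of_forall fun z => by positivity)]
  refine lt_of_le_of_lt ?_
    (lintegral_rpow_neg_dist_lt_top hα !₂[1 - δ, 0] (half_pos hδ))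
  simp_rw [dist_eq_norm]
  refine lintegral_mono_set fun z hz => ?_
  have := userSite_dist_ge hδ' hz
  rw [dist_eq_norm] at this
  exact Set.mem_ofPred.2 (by linarith)

lemma ofReal_Delta {α δ : ℝ} (hα : 2 < α) (hδ : 0 < δ) (hδ' : δ ≤ 1) :
    ENNReal.ofReal (Delta α δ) = ∫⁻ z in (Metric.ball (0 : Plane) 1)ᶜ,
      ENNReal.ofReal (dist z !₂[1 - δ, 0] ^ (-α)) := by
  simp_rw [dist_eq_norm]
  rw [Delta, ofReal_integral_eq_lintegral_ofReal (integrableOn_rpow_neg_norm_sub hα hδ hδ')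
    (.of_forall fun z => by positivity)]

lemma Delta_nonneg (α δ : ℝ) : 0 ≤ Delta α δ := integral_nonneg fun z => by positivity

lemma Delta_pos {α δ : ℝ} (hα : 2 < α) (hδ : 0 < δ) (hδ' : δ ≤ 1) : 0 < Delta α δ := by
  rw [Delta, setIntegral_pos_iff_support_of_nonneg_ae (.of_forall fun z => by positivity)
    (integrableOn_rpow_neg_norm_sub hα hδ hδ')]
  have hsub : (Metric.closedBall (0 : Plane) 1)ᶜ ⊆
      Function.support (fun z : Plane => ‖z - !₂[1 - δ, 0]‖ ^ (-α)) ∩ (Metric.ball 0 1)ᶜ := by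
    intro z hz
    have hz' : z ∉ Metric.ball (0 : Plane) 1 := fun h => hz (Metric.ball_subset_closedBall h)
    have h1 := userSite_dist_ge hδ' hz'
    rw [dist_eq_norm] at h1
    exact ⟨(Real.rpow_pos_of_pos (by linarith) _).ne', hz'⟩
  refine lt_of_lt_of_le (Metric.isClosed_closedBall.isOpen_compl.measure_pos volume ?_)
    (measure_mono hsub)
  by_contra! hempty
  exact (NormedSpace.unbounded_univ ℝ Plane)
    (Metric.isBounded_closedBall.subset (Set.compl_empty_iff.1 hempty).ge)

lemma div_one_add_le_self {w : ℝ} (hw : 0 ≤ w) : w / (1 + w) ≤ w :=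
  div_le_self hw (by linarith)

/-- Drop the denominator `1 + w` and the distance cut-off. The resulting majorant gives finiteness,
continuity in `q` and the limit at 0. -/
lemma extField_unit_le {α T : ℝ} (hα : 0 < α) (hT : 0 < T) {δ q q₀ : ℝ} (hq : 0 ≤ q)
    (hq₀ : q ≤ q₀) (z : Plane) :
    extField (fun w => w / (1 + w)) α T (Metric.ball 0 1) !₂[1 - δ, 0] q q z ≤
      ENNReal.ofReal (T * q₀ ^ α) * (Metric.ball (0 : Plane) 1)ᶜ.indicator
        (fun z => ENNReal.ofReal (dist z !₂[1 - δ, 0] ^ (-α))) z := by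
  refine (extField_le (fun w hw => div_one_add_le_self hw) hα hT _ _ hq hq₀ hq le_rfl z).trans ?_
  rw [← Set.indicator_const_mul]
  exact Set.indicator_le_indicator_of_subset (fun z hz => hz.1) (fun _ => zero_le) z

lemma lintegral_extField_bound {α T δ : ℝ} (hα : 2 < α) (hδ : 0 < δ) (hδ' : δ ≤ 1) (q : ℝ) :
    ∫⁻ z, ENNReal.ofReal (T * q ^ α) * (Metric.ball (0 : Plane) 1)ᶜ.indicator
        (fun z => ENNReal.ofReal (dist z !₂[1 - δ, 0] ^ (-α))) z =
      ENNReal.ofReal (T * q ^ α) * ENNReal.ofReal (Delta α δ) := by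
  rw [lintegral_const_mul _ (Measurable.indicator (by fun_prop) measurableSet_ball.compl),
    lintegral_indicator measurableSet_ball.compl, ofReal_Delta hα hδ hδ']

lemma exteriorMass_le {α T δ : ℝ} (hα : 2 < α) (hT : 0 < T) (hδ : 0 < δ) (hδ' : δ ≤ 1)
    {q : ℝ} (hq : 0 ≤ q) :
    exteriorMass α T δ q ≤ ENNReal.ofReal (T * q ^ α * Delta α δ) := by
  rw [ENNReal.ofReal_mul (by positivity), ← lintegral_extField_bound hα hδ hδ']
  exact lintegral_mono fun z => extField_unit_le (by linarith) hT hq le_rfl z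

lemma exteriorMass_ne_top {α T δ : ℝ} (hα : 2 < α) (hT : 0 < T) (hδ : 0 < δ) (hδ' : δ ≤ 1)
    {q : ℝ} (hq : 0 ≤ q) : exteriorMass α T δ q ≠ ∞ :=
  ne_top_of_le_ne_top ENNReal.ofReal_ne_top (exteriorMass_le hα hT hδ hδ' hq)

lemma toReal_exteriorMass_le {α T δ : ℝ} (hα : 2 < α) (hT : 0 < T) (hδ : 0 < δ) (hδ' : δ ≤ 1)
    {q : ℝ} (hq : 0 ≤ q) : (exteriorMass α T δ q).toReal ≤ T * q ^ α * Delta α δ :=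
  ENNReal.toReal_le_of_le_ofReal (by have := Delta_nonneg α δ; positivity)
    (exteriorMass_le hα hT hδ hδ' hq)

/-- The integrand can jump in `q` at `q₀` only for `z` on the sphere of radius `q₀` around the user,
which has area 0. -/
lemma continuousAt_exteriorMass {α T δ : ℝ} (hα : 2 < α) (hT : 0 < T) (hδ : 0 < δ) (hδ' : δ ≤ 1)
    {q₀ : ℝ} (hq₀ : 0 < q₀) : ContinuousAt (exteriorMass α T δ) q₀ := by
  refine tendsto_lintegral_filter_of_dominated_convergence
    (fun z => ENNReal.ofReal (T * (q₀ + 1) ^ α) * (Metric.ball (0 : Plane) 1)ᶜ.indicator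
        (fun z => ENNReal.ofReal (dist z !₂[1 - δ, 0] ^ (-α))) z)
    (.of_forall fun q => measurable_extField (by fun_prop) α T measurableSet_ball _ _ _) ?_ ?_ ?_
  · filter_upwards [lt_mem_nhds hq₀, gt_mem_nhds (lt_add_one q₀)] with q h1 h2
    exact .of_forall fun z => extField_unit_le (by linarith) hT h1.le h2.le z
  · rw [lintegral_extField_bound hα hδ hδ']
    exact ENNReal.mul_ne_top ENNReal.ofReal_ne_top ENNReal.ofReal_ne_top
  · have hs : volume (Metric.sphere (!₂[1 - δ, 0] : Plane) q₀) = 0 :=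
      Measure.addHaar_sphere _ _ _
    filter_upwards [measure_eq_zero_iff_ae_notMem.1 hs] with z hz
    have hz' : dist z !₂[1 - δ, 0] ≠ q₀ := hz
    by_cases hC : z ∈ Metric.ball (0 : Plane) 1
    · simp [extField_of_mem_region _ α T _ _ _ hC]
    · have hd : 0 < dist z !₂[1 - δ, 0] := hδ.trans_le (userSite_dist_ge hδ' hC)
      rcases lt_or_gt_of_ne hz' with hlt | hgt
      · refine tendsto_const_nhds.congr' ?_
        filter_upwards [lt_mem_nhds hlt] with q hq
        simp [extField, Set.indicator, not_lt.2 hq.le, not_lt.2 hlt.le]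
      · have hc : ContinuousAt (fun q => ENNReal.ofReal ((T * (q / dist z !₂[1 - δ, 0]) ^ α) /
            (1 + T * (q / dist z !₂[1 - δ, 0]) ^ α))) q₀ := by
          have h1 : ContinuousAt (fun q => T * (q / dist z !₂[1 - δ, 0]) ^ α) q₀ :=
            ((continuousAt_id.div_const _).rpow_const (Or.inr (by linarith))).const_mul T
          refine ENNReal.continuous_ofReal.continuousAt.comp
            (h1.div (continuousAt_const.add h1) ?_)
          positivity
        have h3 : extField (fun w => w / (1 + w)) α T (Metric.ball 0 1) !₂[1 - δ, 0] q₀ q₀ z =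
            ENNReal.ofReal ((T * (q₀ / dist z !₂[1 - δ, 0]) ^ α) /
            (1 + T * (q₀ / dist z !₂[1 - δ, 0]) ^ α)) := by
          rw [extField_of_mem _ α T _ hC hgt]
        rw [h3]
        refine hc.tendsto.congr' ?_
        filter_upwards [gt_mem_nhds hgt] with q hq
        rw [extField_of_mem _ α T _ hC hq]

/-- At a fixed exterior point at distance `d`, the cut-off is inactive once `q < d`, and `q^(-α)
w/(1 + w)` tends to `T d^(-α)`, which also dominates it. -/
lemma tendsto_rpow_neg_mul_exteriorMass {α T δ : ℝ} (hα : 2 < α) (hT : 0 < T) (hδ : 0 < δ)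
    (hδ' : δ ≤ 1) :
    Tendsto (fun q => q ^ (-α) * (exteriorMass α T δ q).toReal) (𝓝[>] 0)
      (𝓝 (T * Delta α δ)) := by
  have h1 : Tendsto (fun q => ∫⁻ z, ENNReal.ofReal (q ^ (-α)) *
      extField (fun w => w / (1 + w)) α T (Metric.ball 0 1) !₂[1 - δ, 0] q q z) (𝓝[>] 0)
      (𝓝 (∫⁻ z, ENNReal.ofReal T * (Metric.ball (0 : Plane) 1)ᶜ.indicator
        (fun z => ENNReal.ofReal (dist z !₂[1 - δ, 0] ^ (-α))) z)) := by
    refine tendsto_lintegral_filter_of_dominated_convergence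
      (fun z => ENNReal.ofReal T * (Metric.ball (0 : Plane) 1)ᶜ.indicator
        (fun z => ENNReal.ofReal (dist z !₂[1 - δ, 0] ^ (-α))) z)
      (.of_forall fun q =>
        (measurable_extField (by fun_prop) α T measurableSet_ball _ _ _).const_mul _) ?_ ?_
      (.of_forall fun z => ?_)
    · filter_upwards [self_mem_nhdsWithin] with q hq
      have hq' : (0 : ℝ) < q := hq
      refine .of_forall fun z => ?_
      refine (mul_le_mul_right (extField_unit_le (by linarith) hT hq'.le le_rfl z) _).trans ?_
      rw [← mul_assoc, ← ENNReal.ofReal_mul (by positivity), mul_left_comm, ← Real.rpow_add hq']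
      simp
    · have := lintegral_extField_bound (T := T) hα hδ hδ' 1
      rw [Real.one_rpow, mul_one] at this
      rw [this]
      exact ENNReal.mul_ne_top ENNReal.ofReal_ne_top ENNReal.ofReal_ne_top
    · by_cases hC : z ∈ Metric.ball (0 : Plane) 1
      · simp [extField_of_mem_region _ α T _ _ _ hC, hC]
      · have hd : 0 < dist z !₂[1 - δ, 0] := hδ.trans_le (userSite_dist_ge hδ' hC)
        set d := dist z !₂[1 - δ, 0] with hd_def
        have hlim : Tendsto (fun q : ℝ => ENNReal.ofReal (T * d ^ (-α) / (1 + T * (q / d) ^ α)))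
            (𝓝[>] 0) (𝓝 (ENNReal.ofReal (T * d ^ (-α)))) := by
          have h1 : ContinuousAt (fun q : ℝ => T * (q / d) ^ α) 0 :=
            ((continuousAt_id.div_const _).rpow_const (Or.inr (by linarith))).const_mul T
          have h2 : ContinuousAt (fun q : ℝ => T * d ^ (-α) / (1 + T * (q / d) ^ α)) 0 :=
            continuousAt_const.div (continuousAt_const.add h1)
              (by rw [zero_div, Real.zero_rpow (by linarith)]; simp)
          have h3 := h2.tendsto
          rw [zero_div, Real.zero_rpow (by linarith), mul_zero, add_zero, div_one] at h3
          exact ((ENNReal.continuous_ofReal.tendsto _).comp h3).mono_left nhdsWithin_le_nhds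
        rw [Set.indicator_of_mem (show z ∈ (Metric.ball (0 : Plane) 1)ᶜ from hC), ← hd_def,
          ← ENNReal.ofReal_mul hT.le]
        refine hlim.congr' ?_
        filter_upwards [self_mem_nhdsWithin, mem_nhdsWithin_of_mem_nhds (gt_mem_nhds hd)]
          with q hq hqd
        have hq' : (0 : ℝ) < q := hq
        rw [extField_of_mem _ α T _ hC hqd, ← ENNReal.ofReal_mul (by positivity),
          ← hd_def]
        congr 1
        rw [mul_div_assoc', Real.div_rpow hq'.le hd.le, Real.rpow_neg hq'.le,
          Real.rpow_neg hd.le]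
        have := Real.rpow_pos_of_pos hq' α
        congr 1
        field_simp
  have h2 := lintegral_extField_bound (T := T) hα hδ hδ' 1
  rw [Real.one_rpow, mul_one] at h2
  rw [h2, ← ENNReal.ofReal_mul hT.le] at h1
  have h3 := (ENNReal.tendsto_toReal ENNReal.ofReal_ne_top).comp h1
  rw [ENNReal.toReal_ofReal (mul_nonneg hT.le (Delta_nonneg α δ))] at h3
  refine h3.congr' ?_
  filter_upwards [self_mem_nhdsWithin] with q hq
  have hq' : (0 : ℝ) < q := hq
  rw [Function.comp, lintegral_const_mul _
    (measurable_extField (by fun_prop) α T measurableSet_ball _ _ _), ENNReal.toReal_mul,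
    ENNReal.toReal_ofReal (by positivity)]
  rfl

lemma measurable_exteriorMass (α T δ : ℝ) : Measurable (exteriorMass α T δ) :=
  measurable_lintegral_extField (by fun_prop) α T measurableSet_ball _

end

/-! ### First passage, moments of the nearest distance, and coverage formulas. -/

section

/-- First passage of a decreasing continuous function with power decay `D R ~ c R^(-β)`. -/
theorem isLeast_and_isEquivalent_sInf_of_tendsto_rpow_mul {D : ℝ → ℝ} {β c : ℝ} (hβ : 0 < β)
    (hc : 0 < c) (hanti : ∀ R R', 0 < R → R ≤ R' → D R' ≤ D R)
    (hcont : ContinuousOn D (Set.Ioi 0))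
    (hlim : Tendsto (fun R => R ^ β * D R) atTop (𝓝 c)) :
    (∀ᶠ ε in 𝓝[>] (0 : ℝ), IsLeast {R | 0 < R ∧ D R = ε} (sInf {R | 0 < R ∧ D R = ε})) ∧
    (fun ε => sInf {R | 0 < R ∧ D R = ε}) ~[𝓝[>] (0 : ℝ)] fun ε => (c * ε⁻¹) ^ (1 / β) := by
  have hpos : ∀ R, 0 < R → 0 < D R := by
    intro R hR
    obtain ⟨M, hM, hRM, hM0⟩ := ((hlim.eventually (lt_mem_nhds hc)).and
      ((eventually_ge_atTop R).and (eventually_gt_atTop 0))).exists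
    have : 0 < D M := pos_of_mul_pos_right hM (Real.rpow_nonneg hM0.le _)
    exact this.trans_le (hanti R M hR hRM)
  have hzero : Tendsto D atTop (𝓝 0) := by
    have h1 := (tendsto_rpow_neg_atTop hβ).mul hlim
    rw [zero_mul] at h1
    refine h1.congr' ?_
    filter_upwards [eventually_gt_atTop 0] with R hR
    rw [← mul_assoc, ← Real.rpow_add hR]
    simp
  have hgt : ∀ M ε R, 0 < M → ε < D M → 0 < R ∧ D R = ε → M < R := by
    intro M ε R hM hε hR
    by_contra! hle
    have := hanti R M hR.1 hle
    linarith [hR.2]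
  have hleast : ∀ ε, 0 < ε → ε < D 1 →
      IsLeast {R | 0 < R ∧ D R = ε} (sInf {R | 0 < R ∧ D R = ε}) := by
    intro ε hε hε1
    have hbdd : BddBelow {R | 0 < R ∧ D R = ε} := ⟨0, fun R hR => hR.1.le⟩
    have hne : {R | 0 < R ∧ D R = ε}.Nonempty := by
      obtain ⟨M, hM, hM1⟩ := ((hzero.eventually (gt_mem_nhds hε)).and
        (eventually_ge_atTop 1)).exists
      have hsub : Set.Icc 1 M ⊆ Set.Ioi (0 : ℝ) := fun R hR => one_pos.trans_le hR.1
      obtain ⟨R, hR, hRε⟩ := intermediate_value_Icc' hM1 (hcont.mono hsub) ⟨hM.le, hε1.le⟩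
      exact ⟨R, hsub hR, hRε⟩
    -- Since `ε < D 1`, all solutions lie in `[1, ∞)`, away from the open endpoint 0, so the infimum
    -- is attained.
    have hclosed : IsClosed {R | 0 < R ∧ D R = ε} := by
      have heq : {R | 0 < R ∧ D R = ε} = Set.Ici 1 ∩ D ⁻¹' {ε} := by
        ext R
        refine ⟨fun hR => ⟨(hgt 1 ε R one_pos hε1 hR).le, hR.2⟩,
          fun hR => ⟨one_pos.trans_le hR.1, hR.2⟩⟩
      rw [heq]
      exact (hcont.mono fun R (hR : R ∈ Set.Ici (1 : ℝ)) =>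
        Set.mem_Ioi.2 (lt_of_lt_of_le one_pos hR)).preimage_isClosed_of_isClosed
        isClosed_Ici isClosed_singleton
    exact ⟨hclosed.csInf_mem hne hbdd, fun R hR => csInf_le hbdd hR⟩
  have hev : ∀ M, 0 < M → ∀ᶠ ε in 𝓝[>] (0 : ℝ), 0 < ε ∧ ε < D M := fun M hM =>
    Filter.Eventually.and self_mem_nhdsWithin (mem_nhdsWithin_of_mem_nhds (gt_mem_nhds (hpos M hM)))
  have hevleast : ∀ᶠ ε in 𝓝[>] (0 : ℝ),
      IsLeast {R | 0 < R ∧ D R = ε} (sInf {R | 0 < R ∧ D R = ε}) := by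
    filter_upwards [hev 1 one_pos] with ε hε
    exact hleast ε hε.1 hε.2
  refine ⟨hevleast, ?_⟩
  have htop : Tendsto (fun ε => sInf {R | 0 < R ∧ D R = ε}) (𝓝[>] (0 : ℝ)) atTop := by
    rw [tendsto_atTop]
    intro M
    filter_upwards [hevleast, hev (max M 1) (by positivity)] with ε h1 h2
    exact (le_max_left M 1).trans (hgt _ ε _ (by positivity) h2.2 h1.1).le
  -- Along the first passage radius `R → ∞` one has `D R = ε`, hence `R^β ε / c → 1`; the power
  -- `1/β` isolates `R`.
  have h1 := ((hlim.comp htop).div_const c).rpow_const (p := 1 / β)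
    (Or.inl (by rw [div_self hc.ne']; exact one_ne_zero))
  rw [div_self hc.ne', Real.one_rpow] at h1
  refine isEquivalent_of_tendsto_one (h1.congr' ?_)
  filter_upwards [hevleast, self_mem_nhdsWithin] with ε h2 h3
  have hε : (0 : ℝ) < ε := h3
  obtain ⟨h4, h5⟩ := h2.1
  simp only [Function.comp, Pi.div_apply]
  rw [h5]
  set R := sInf {R | 0 < R ∧ D R = ε}
  rw [mul_div_assoc, Real.mul_rpow (by positivity) (by positivity), ← Real.rpow_mul h4.le,
    mul_one_div_cancel hβ.ne', Real.rpow_one, ← inv_div, Real.inv_rpow (by positivity),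
    ← div_eq_mul_inv, div_eq_mul_inv c]

variable {Ω : Type*} [MeasurableSpace Ω] {P : Measure Ω} {lam : ℝ} {X : ℕ → Ω → Plane}
  {h : ℕ → Ω → ℂ}

/-- Moments of the distance to the nearest station. -/
lemma IsPoissonProcess.lintegral_nearestDist_rpow [IsProbabilityMeasure P]
    (hX : IsPoissonProcess P lam X) (hlam : 0 < lam) {α : ℝ} (hα : 0 < α) :
    ∫⁻ ω, ENNReal.ofReal (nearestDist X ω ^ α) ∂P =
      ENNReal.ofReal (Real.pi ^ (-α / 2) * lam ^ (-α / 2) * Real.Gamma (α / 2 + 1)) := by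
  have hb : 0 < lam * Real.pi := mul_pos hlam Real.pi_pos
  -- The layer-cake formula with the void tail `exp(-λ π t²)` leads to a Gamma integral.
  rw [lintegral_rpow_eq_lintegral_meas_le_mul P (.of_forall nearestDist_nonneg)
    hX.measurable_nearestDist.aemeasurable hα]
  have h1 : ∀ t ∈ Set.Ioi (0 : ℝ), P {ω | t ≤ nearestDist X ω} * ENNReal.ofReal (t ^ (α - 1)) =
      ENNReal.ofReal (t ^ (α - 1) * Real.exp (-(lam * Real.pi) * t ^ (2 : ℝ))) := by
    intro t ht
    have ht' : (0 : ℝ) < t := ht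
    have h2 := hX.measure_le_distToNearest 0 t
    rw [volume_plane_ball _ ht'.le, ← ENNReal.ofReal_mul hlam.le, expNeg_ofReal (by positivity)]
      at h2
    change P {ω | t ≤ distToNearest X 0 ω} * _ = _
    rw [h2, ← ENNReal.ofReal_mul (by positivity), mul_comm, Real.rpow_two]
    congr 3
    ring
  rw [setLIntegral_congr_fun measurableSet_Ioi h1, ← ofReal_integral_eq_lintegral_ofReal
    (integrableOn_rpow_mul_exp_neg_mul_rpow (by linarith) two_pos hb)
    ((ae_restrict_iff' measurableSet_Ioi).2 (.of_forall fun t ht => ?_)),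
    integral_rpow_mul_exp_neg_mul_rpow two_pos (by linarith) hb, ← ENNReal.ofReal_mul hα.le]
  · rw [sub_add_cancel, Real.Gamma_add_one (by positivity),
      Real.mul_rpow hlam.le Real.pi_pos.le]
    congr 1
    ring
  · have : (0 : ℝ) < t := ht
    positivity

lemma IsPoissonProcess.integrable_nearestDist_rpow [IsProbabilityMeasure P]
    (hX : IsPoissonProcess P lam X) (hlam : 0 < lam) {α : ℝ} (hα : 0 < α) :
    Integrable (fun ω => nearestDist X ω ^ α) P := by
  refine ⟨(hX.measurable_nearestDist.pow_const α).aestronglyMeasurable, ?_⟩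
  rw [hasFiniteIntegral_iff_ofReal (.of_forall fun ω => Real.rpow_nonneg (nearestDist_nonneg ω) _),
    hX.lintegral_nearestDist_rpow hlam hα]
  exact ENNReal.ofReal_lt_top

lemma IsPoissonProcess.integral_nearestDist_rpow [IsProbabilityMeasure P]
    (hX : IsPoissonProcess P lam X) (hlam : 0 < lam) {α : ℝ} (hα : 0 < α) :
    ∫ ω, nearestDist X ω ^ α ∂P =
      Real.pi ^ (-α / 2) * lam ^ (-α / 2) * Real.Gamma (α / 2 + 1) := by
  rw [integral_eq_lintegral_of_nonneg_ae
    (.of_forall fun ω => Real.rpow_nonneg (nearestDist_nonneg ω) _)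
    (hX.measurable_nearestDist.pow_const α).aestronglyMeasurable,
    hX.lintegral_nearestDist_rpow hlam hα, ENNReal.toReal_ofReal]
  have := Real.Gamma_pos_of_pos (show 0 < α / 2 + 1 by positivity)
  positivity

lemma IsPoissonProcess.meanClusterSize_eq (hX : IsPoissonProcess P lam X) (hlam : 0 < lam)
    {R : ℝ} (hR : 0 ≤ R) :
    meanClusterSize P X R = ENNReal.ofReal (lam * Real.pi * R ^ 2) := by
  have h1 := hX.lintegral_pointMeasure_apply (A := Metric.ball 0 R) measurableSet_ball
    measure_ball_lt_top
  simp_rw [pointMeasure_apply _ (measurableSet_ball (x := (0 : Plane)) (ε := R))] at h1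
  rw [meanClusterSize, h1, volume_plane_ball _ hR, ← ENNReal.ofReal_mul hlam.le, mul_assoc]

lemma idealCoverage_eq [IsProbabilityMeasure P] (hX : IsPoissonProcess P lam X)
    (hh : ∀ n, Measurable (h n)) (hlaw : ∀ n, HasLaw (h n) stdComplexGaussian P)
    (hind : iIndepFun h P) (hXh : IndepFun (fun ω n => X n ω) (fun ω n => h n ω) P)
    {α T : ℝ} (σ : ℝ) (hα : 2 < α) (hT : 0 < T) :
    idealCoverage P α σ T X h = ∫ ω, Real.exp (-T * σ ^ 2 * nearestDist X ω ^ α) ∂P := by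
  have hm := hX.measurable_nearestDist
  rw [idealCoverage, coverage_eq_toReal_lintegral_nearestDist hX hh hlaw hind hXh hα hT _ .univ,
    integral_eq_lintegral_of_nonneg_ae (.of_forall fun ω => (Real.exp_pos _).le)
      (Measurable.aestronglyMeasurable (by fun_prop))]
  congr 1
  refine lintegral_congr fun ω => ?_
  have := nearestDist_nonneg (X := X) ω
  rw [expNeg_ofReal (by positivity)]
  simp_rw [extField_of_mem_region _ α T _ _ _ (Set.mem_univ _)]
  rw [lintegral_zero, mul_zero, expNeg_zero, mul_one]
  congr 2
  ring

/-- The average over the nearest distance combined with scaling. Finiteness of the exterior mass,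
from `δ > 0`, allows real exponentials. -/
lemma clusterCoverage_eq [IsProbabilityMeasure P] (hX : IsPoissonProcess P lam X)
    (hlam : 0 < lam)
    (hh : ∀ n, Measurable (h n)) (hlaw : ∀ n, HasLaw (h n) stdComplexGaussian P)
    (hind : iIndepFun h P) (hXh : IndepFun (fun ω n => X n ω) (fun ω n => h n ω) P)
    {α T δ : ℝ} (σ : ℝ) (hα : 2 < α) (hT : 0 < T) (hδ : 0 < δ) (hδ' : δ ≤ 1)
    {R : ℝ} (hR : 0 < R) :
    clusterCoverage P α σ T X h δ R = ∫ ω, Real.exp (-T * σ ^ 2 * nearestDist X ω ^ α) *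
      Real.exp (-(lam * (R ^ 2 * (exteriorMass α T δ (nearestDist X ω / R)).toReal))) ∂P := by
  have hm := hX.measurable_nearestDist
  have hM := measurable_exteriorMass α T δ
  rw [clusterCoverage,
    coverage_eq_toReal_lintegral_nearestDist hX hh hlaw hind hXh hα hT _ measurableSet_ball,
    integral_eq_lintegral_of_nonneg_ae (.of_forall fun ω => by positivity)
      (Measurable.aestronglyMeasurable (by fun_prop))]
  congr 1
  refine lintegral_congr fun ω => ?_
  have h0 := nearestDist_nonneg (X := X) ω
  have h1 : exteriorMass α T δ (nearestDist X ω / R) =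
      ENNReal.ofReal (exteriorMass α T δ (nearestDist X ω / R)).toReal :=
    (ENNReal.ofReal_toReal (exteriorMass_ne_top hα hT hδ hδ' (by positivity))).symm
  rw [expNeg_ofReal (by positivity), lintegral_extField_scale α T δ hR, h1,
    ← ENNReal.ofReal_mul (by positivity), ← ENNReal.ofReal_mul hlam.le,
    expNeg_ofReal (by positivity), ENNReal.ofReal_mul (by positivity), ← h1]
  congr 3
  ring

end

/-! ### Asymptotics of the coverage loss. -/

section

variable {Ω : Type*} [MeasurableSpace Ω] {P : Measure Ω} {lam : ℝ} {X : ℕ → Ω → Plane}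
  {h : ℕ → Ω → ℂ}

omit [MeasurableSpace Ω] in
lemma exp_noise_le_one {α T : ℝ} (σ : ℝ) (hT : 0 < T) (ω : Ω) :
    Real.exp (-T * σ ^ 2 * nearestDist X ω ^ α) ≤ 1 := by
  rw [Real.exp_le_one_iff]
  have h1 := Real.rpow_nonneg (nearestDist_nonneg (X := X) ω) α
  have h2 : 0 ≤ T * σ ^ 2 * nearestDist X ω ^ α := by positivity
  linarith

lemma integrable_exp_noise [IsProbabilityMeasure P] (hX : IsPoissonProcess P lam X) {α T : ℝ}
    (σ : ℝ) (hT : 0 < T) :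
    Integrable (fun ω => Real.exp (-T * σ ^ 2 * nearestDist X ω ^ α)) P := by
  have hm := hX.measurable_nearestDist
  refine Integrable.of_bound (Measurable.aestronglyMeasurable (by fun_prop)) 1
    (.of_forall fun ω => ?_)
  rw [Real.norm_of_nonneg (Real.exp_pos _).le]
  exact exp_noise_le_one σ hT ω

lemma integral_exp_noise_pos [IsProbabilityMeasure P] (hX : IsPoissonProcess P lam X) {α T : ℝ}
    (σ : ℝ) (hT : 0 < T) : 0 < ∫ ω, Real.exp (-T * σ ^ 2 * nearestDist X ω ^ α) ∂P :=
  integral_exp_pos (integrable_exp_noise hX σ hT)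

/-- The nearest distance is almost surely positive. This makes `η`, hence the first passage
constant, positive. -/
lemma integral_exp_noise_mul_rpow_pos [IsProbabilityMeasure P] (hX : IsPoissonProcess P lam X)
    (hlam : 0 < lam) {α T : ℝ} (σ : ℝ) (hα : 0 < α) (hT : 0 < T) :
    0 < ∫ ω, Real.exp (-T * σ ^ 2 * nearestDist X ω ^ α) * nearestDist X ω ^ α ∂P := by
  have hm := hX.measurable_nearestDist
  have hint : Integrable (fun ω => Real.exp (-T * σ ^ 2 * nearestDist X ω ^ α) *
      nearestDist X ω ^ α) P := by
    refine (hX.integrable_nearestDist_rpow hlam hα).mono'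
      (Measurable.aestronglyMeasurable (by fun_prop)) (.of_forall fun ω => ?_)
    have h1 := Real.rpow_nonneg (nearestDist_nonneg (X := X) ω) α
    rw [Real.norm_of_nonneg (by positivity)]
    exact mul_le_of_le_one_left h1 (exp_noise_le_one σ hT ω)
  have hpos : ∀ᵐ ω ∂P, 0 < Real.exp (-T * σ ^ 2 * nearestDist X ω ^ α) * nearestDist X ω ^ α := by
    filter_upwards [hX.ae_nearestDist_pos] with ω hω
    positivity
  rw [integral_pos_iff_support_of_nonneg_ae (hpos.mono fun ω hω => hω.le) hint]
  have h1 : Function.support (fun ω => Real.exp (-T * σ ^ 2 * nearestDist X ω ^ α) *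
      nearestDist X ω ^ α) =ᵐ[P] Set.univ := by
    filter_upwards [hpos] with ω hω
    exact propext ⟨fun _ => trivial, fun _ => hω.ne'⟩
  rw [measure_congr h1, measure_univ]
  exact one_pos

/-- The interference term at the nearest distance `s`, divided by its asymptotic order. -/
lemma rpow_mul_exteriorMass_le {α T δ : ℝ} (hα : 2 < α) (hT : 0 < T) (hδ : 0 < δ) (hδ' : δ ≤ 1)
    (hlam : 0 < lam) {s R : ℝ} (hs : 0 ≤ s) (hR : 0 < R) :
    R ^ (α - 2) * (lam * (R ^ 2 * (exteriorMass α T δ (s / R)).toReal)) ≤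
      lam * T * Delta α δ * s ^ α := by
  have h1 := toReal_exteriorMass_le hα hT hδ hδ' (div_nonneg hs hR.le)
  calc R ^ (α - 2) * (lam * (R ^ 2 * (exteriorMass α T δ (s / R)).toReal))
      ≤ R ^ (α - 2) * (lam * (R ^ 2 * (T * (s / R) ^ α * Delta α δ))) := by gcongr
    _ = lam * T * Delta α δ * s ^ α := by
      rw [Real.rpow_sub hR, Real.rpow_two, Real.div_rpow hs hR.le]
      have := Real.rpow_pos_of_pos hR α
      field_simp

/-- Put `q = s/R`, so that `R^(α-2) R² = s^α q^(-α)`, and use the behaviour of the exterior mass as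
`q → 0⁺`. -/
lemma tendsto_rpow_mul_exteriorMass {α T δ : ℝ} (hα : 2 < α) (hT : 0 < T) (hδ : 0 < δ)
    (hδ' : δ ≤ 1) {s : ℝ} (hs : 0 < s) :
    Tendsto (fun R => R ^ (α - 2) * (lam * (R ^ 2 * (exteriorMass α T δ (s / R)).toReal))) atTop
      (𝓝 (lam * T * Delta α δ * s ^ α)) := by
  have h1 : Tendsto (fun R => s / R) atTop (𝓝[>] 0) :=
    tendsto_nhdsWithin_iff.2 ⟨tendsto_const_nhds.div_atTop tendsto_id,
      (eventually_gt_atTop 0).mono fun R hR => div_pos hs hR⟩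
  have h2 := (((tendsto_rpow_neg_mul_exteriorMass hα hT hδ hδ').comp h1).const_mul
    (lam * s ^ α))
  rw [show lam * T * Delta α δ * s ^ α = lam * s ^ α * (T * Delta α δ) by ring]
  refine h2.congr' ?_
  filter_upwards [eventually_gt_atTop 0] with R hR
  rw [Function.comp, Real.rpow_sub hR, Real.rpow_two, Real.rpow_neg (by positivity),
    Real.div_rpow hs.le hR.le]
  have := Real.rpow_pos_of_pos hR α
  have := Real.rpow_pos_of_pos hs α
  field_simp

/-- Squeeze by `y/(1 + y) ≤ 1 - e^{-y} ≤ y`. -/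
lemma tendsto_mul_one_sub_exp_neg {ι : Type*} {l : Filter ι} {b y : ι → ℝ} {L : ℝ}
    (hb : ∀ᶠ i in l, 0 ≤ b i) (hy : ∀ᶠ i in l, 0 ≤ y i) (hy0 : Tendsto y l (𝓝 0))
    (hby : Tendsto (fun i => b i * y i) l (𝓝 L)) :
    Tendsto (fun i => b i * (1 - Real.exp (-y i))) l (𝓝 L) := by
  have h1 : Tendsto (fun i => b i * y i / (1 + y i)) l (𝓝 L) := by
    have h2 := hby.div (hy0.const_add 1) (by simp)
    rwa [add_zero, div_one] at h2
  refine tendsto_of_tendsto_of_tendsto_of_le_of_le' h1 hby ?_ ?_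
  · filter_upwards [hb, hy] with i hbi hyi
    rw [mul_div_assoc]
    refine mul_le_mul_of_nonneg_left ?_ hbi
    rw [Real.exp_neg, div_le_iff₀ (by linarith)]
    have h2 := Real.add_one_le_exp (y i)
    have h3 : (Real.exp (y i))⁻¹ * (1 + y i) ≤ 1 := by
      rw [inv_mul_le_iff₀ (Real.exp_pos _)]
      linarith
    linarith
  · filter_upwards [hb, hy] with i hbi hyi
    refine mul_le_mul_of_nonneg_left ?_ hbi
    linarith [Real.add_one_le_exp (-y i)]

section Coverage

variable [IsProbabilityMeasure P]

lemma integrable_cluster (hX : IsPoissonProcess P lam X) (hlam : 0 < lam)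
    {α T δ : ℝ} (σ : ℝ) (hT : 0 < T) (R : ℝ) :
    Integrable (fun ω => Real.exp (-T * σ ^ 2 * nearestDist X ω ^ α) *
      Real.exp (-(lam * (R ^ 2 * (exteriorMass α T δ (nearestDist X ω / R)).toReal)))) P := by
  have hm := hX.measurable_nearestDist
  have hM := measurable_exteriorMass α T δ
  refine Integrable.of_bound (Measurable.aestronglyMeasurable (by fun_prop)) 1
    (.of_forall fun ω => ?_)
  rw [Real.norm_of_nonneg (by positivity)]
  refine mul_le_one₀ (exp_noise_le_one σ hT ω) (Real.exp_pos _).le (Real.exp_le_one_iff.2 ?_)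
  have : 0 ≤ lam * (R ^ 2 * (exteriorMass α T δ (nearestDist X ω / R)).toReal) := by positivity
  linarith

/-- The coverage loss decays like `R ^ (2 - α)`. -/
theorem tendsto_rpow_mul_coverage_loss (hX : IsPoissonProcess P lam X) (hlam : 0 < lam)
    (hh : ∀ n, Measurable (h n)) (hlaw : ∀ n, HasLaw (h n) stdComplexGaussian P)
    (hind : iIndepFun h P) (hXh : IndepFun (fun ω n => X n ω) (fun ω n => h n ω) P)
    {α T δ : ℝ} (σ : ℝ) (hα : 2 < α) (hT : 0 < T) (hδ : 0 < δ) (hδ' : δ ≤ 1) :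
    Tendsto (fun R => R ^ (α - 2) *
        (idealCoverage P α σ T X h - clusterCoverage P α σ T X h δ R)) atTop
      (𝓝 (lam * T * Delta α δ *
        ∫ ω, Real.exp (-T * σ ^ 2 * nearestDist X ω ^ α) * nearestDist X ω ^ α ∂P)) := by
  have hm := hX.measurable_nearestDist
  have hM := measurable_exteriorMass α T δ
  let y : ℝ → Ω → ℝ := fun R ω =>
    lam * (R ^ 2 * (exteriorMass α T δ (nearestDist X ω / R)).toReal)
  have hy : ∀ R ω, 0 ≤ y R ω := fun R ω => by positivity
  let a : Ω → ℝ := fun ω => Real.exp (-T * σ ^ 2 * nearestDist X ω ^ α)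
  -- The rescaled loss is at most `λ T Δ r^α` for every `R > 0`, and `r^α` is integrable.
  have key : Tendsto (fun R => ∫ ω, a ω * (R ^ (α - 2) * (1 - Real.exp (-y R ω))) ∂P) atTop
      (𝓝 (∫ ω, a ω * (lam * T * Delta α δ * nearestDist X ω ^ α) ∂P)) := by
    refine tendsto_integral_filter_of_dominated_convergence
      (fun ω => lam * T * Delta α δ * nearestDist X ω ^ α)
      (.of_forall fun R => Measurable.aestronglyMeasurable (by fun_prop)) ?_
      ((hX.integrable_nearestDist_rpow hlam (by linarith)).const_mul _) ?_
    · filter_upwards [eventually_gt_atTop 0] with R hR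
      refine .of_forall fun ω => ?_
      have h1 : 0 ≤ R ^ (α - 2) * (1 - Real.exp (-y R ω)) :=
        mul_nonneg (by positivity) (by
          have : Real.exp (-y R ω) ≤ 1 := Real.exp_le_one_iff.2 (neg_nonpos.2 (hy R ω))
          linarith)
      rw [Real.norm_of_nonneg (mul_nonneg (Real.exp_pos _).le h1)]
      calc a ω * (R ^ (α - 2) * (1 - Real.exp (-y R ω)))
          ≤ R ^ (α - 2) * (1 - Real.exp (-y R ω)) :=
            mul_le_of_le_one_left h1 (exp_noise_le_one σ hT ω)
        _ ≤ R ^ (α - 2) * y R ω := by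
            refine mul_le_mul_of_nonneg_left ?_ (by positivity)
            linarith [Real.add_one_le_exp (-y R ω)]
        _ ≤ _ := rpow_mul_exteriorMass_le hα hT hδ hδ' hlam (nearestDist_nonneg ω) hR
    · filter_upwards [hX.ae_nearestDist_pos] with ω hω
      have h1 : Tendsto (fun R => R ^ (α - 2) * y R ω) atTop
          (𝓝 (lam * T * Delta α δ * nearestDist X ω ^ α)) :=
        tendsto_rpow_mul_exteriorMass hα hT hδ hδ' hω
      have h2 : Tendsto (fun R => y R ω) atTop (𝓝 0) := by
        have h3 := (tendsto_rpow_neg_atTop (show 0 < α - 2 by linarith)).mul h1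
        rw [zero_mul] at h3
        refine h3.congr' ?_
        filter_upwards [eventually_gt_atTop 0] with R hR
        rw [← mul_assoc, ← Real.rpow_add hR]
        simp
      exact (tendsto_mul_one_sub_exp_neg
        ((eventually_gt_atTop 0).mono fun R hR => Real.rpow_nonneg hR.le _)
        (.of_forall fun R => hy R ω) h2 h1).const_mul _
  have hlimeq : ∫ ω, a ω * (lam * T * Delta α δ * nearestDist X ω ^ α) ∂P =
      lam * T * Delta α δ * ∫ ω, a ω * nearestDist X ω ^ α ∂P := by
    rw [← integral_const_mul]
    congr with ω
    ring
  rw [hlimeq] at key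
  refine key.congr' ?_
  filter_upwards [eventually_gt_atTop 0] with R hR
  rw [idealCoverage_eq hX hh hlaw hind hXh σ hα hT,
    clusterCoverage_eq hX hlam hh hlaw hind hXh σ hα hT hδ hδ' hR,
    ← integral_sub (integrable_exp_noise hX σ hT) (integrable_cluster hX hlam σ hT R),
    ← integral_const_mul]
  congr with ω
  simp only [a, y]
  ring

lemma continuousOn_clusterCoverage (hX : IsPoissonProcess P lam X) (hlam : 0 < lam)
    (hh : ∀ n, Measurable (h n)) (hlaw : ∀ n, HasLaw (h n) stdComplexGaussian P)
    (hind : iIndepFun h P) (hXh : IndepFun (fun ω n => X n ω) (fun ω n => h n ω) P)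
    {α T δ : ℝ} (σ : ℝ) (hα : 2 < α) (hT : 0 < T) (hδ : 0 < δ) (hδ' : δ ≤ 1) :
    ContinuousOn (clusterCoverage P α σ T X h δ) (Set.Ioi 0) := by
  have hm := hX.measurable_nearestDist
  have hM := measurable_exteriorMass α T δ
  refine ContinuousOn.congr (f := fun R => ∫ ω, Real.exp (-T * σ ^ 2 * nearestDist X ω ^ α) *
      Real.exp (-(lam * (R ^ 2 * (exteriorMass α T δ (nearestDist X ω / R)).toReal))) ∂P) ?_
    fun R hR => clusterCoverage_eq hX hlam hh hlaw hind hXh σ hα hT hδ hδ' hR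
  intro R₀ hR₀
  have hR₀' : (0 : ℝ) < R₀ := hR₀
  refine ContinuousAt.continuousWithinAt ?_
  refine tendsto_integral_filter_of_dominated_convergence (fun _ => (1 : ℝ))
    (.of_forall fun R => Measurable.aestronglyMeasurable (by fun_prop)) ?_
    (integrable_const _) ?_
  · refine .of_forall fun R => .of_forall fun ω => ?_
    rw [Real.norm_of_nonneg (by positivity)]
    refine mul_le_one₀ (exp_noise_le_one σ hT ω) (Real.exp_pos _).le (Real.exp_le_one_iff.2 ?_)
    have : 0 ≤ lam * (R ^ 2 * (exteriorMass α T δ (nearestDist X ω / R)).toReal) := by positivity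
    linarith
  · filter_upwards [hX.ae_nearestDist_pos] with ω hω
    have hq : 0 < nearestDist X ω / R₀ := div_pos hω hR₀'
    have h1 : ContinuousAt (fun R => exteriorMass α T δ (nearestDist X ω / R)) R₀ :=
      ContinuousAt.comp (f := fun R => nearestDist X ω / R)
        (continuousAt_exteriorMass hα hT hδ hδ' hq)
        (continuousAt_const.div continuousAt_id hR₀'.ne')
    have h2 : ContinuousAt (fun R => (exteriorMass α T δ (nearestDist X ω / R)).toReal) R₀ :=
      (ENNReal.tendsto_toReal (exteriorMass_ne_top hα hT hδ hδ' hq.le)).comp h1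
    have h3 : ContinuousAt (fun R => Real.exp (-T * σ ^ 2 * nearestDist X ω ^ α) *
      Real.exp (-(lam * (R ^ 2 * (exteriorMass α T δ (nearestDist X ω / R)).toReal)))) R₀ := by
      fun_prop
    exact h3

lemma clusterCoverage_mono (hX : IsPoissonProcess P lam X)
    (hh : ∀ n, Measurable (h n)) (hlaw : ∀ n, HasLaw (h n) stdComplexGaussian P)
    (hind : iIndepFun h P) (hXh : IndepFun (fun ω n => X n ω) (fun ω n => h n ω) P)
    {α T δ : ℝ} (σ : ℝ) (hα : 2 < α) (hT : 0 < T) (hδ : 0 < δ) (hδ' : δ ≤ 1) :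
    Monotone (clusterCoverage P α σ T X h δ) := by
  intro R R' hRR'
  simp only [clusterCoverage]
  rw [coverage_eq_toReal_lintegral_nearestDist hX hh hlaw hind hXh hα hT _ measurableSet_ball,
    coverage_eq_toReal_lintegral_nearestDist hX hh hlaw hind hXh hα hT _ measurableSet_ball]
  refine ENNReal.toReal_mono (ne_top_of_le_ne_top ENNReal.one_ne_top ?_)
    (lintegral_mono fun ω => ?_)
  · calc _ ≤ ∫⁻ _, 1 ∂P := lintegral_mono fun ω =>
          mul_le_one' (expNeg_le_one _) (expNeg_le_one _)
      _ = 1 := by simp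
  · gcongr
    exact expNeg_antitone (mul_le_mul_right
      (lintegral_extField_cluster_antitone hδ hδ' hRR' _) _)

/-- Existence and scaling of the smallest admissible cluster radius. -/
theorem optRadius_isLeast_and_isEquivalent (hX : IsPoissonProcess P lam X) (hlam : 0 < lam)
    (hh : ∀ n, Measurable (h n)) (hlaw : ∀ n, HasLaw (h n) stdComplexGaussian P)
    (hind : iIndepFun h P) (hXh : IndepFun (fun ω n => X n ω) (fun ω n => h n ω) P)
    {α T δ : ℝ} (σ : ℝ) (hα : 2 < α) (hT : 0 < T) (hδ : 0 < δ) (hδ' : δ ≤ 1) :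
    (∀ᶠ ε in 𝓝[>] (0 : ℝ), IsLeast (admissibleRadii P α σ T X h δ ε)
        (optRadius P α σ T X h δ ε)) ∧
      (fun ε => optRadius P α σ T X h δ ε) ~[𝓝[>] (0 : ℝ)]
        (fun ε => (lam * T * Delta α δ * eta P α σ T X * ε⁻¹) ^ (1 / (α - 2))) := by
  have hideal := idealCoverage_eq hX hh hlaw hind hXh σ hα hT
  have hE : 0 < idealCoverage P α σ T X h := by
    rw [hideal]; exact integral_exp_noise_pos hX σ hT
  have hN := integral_exp_noise_mul_rpow_pos hX hlam σ (show 0 < α by linarith) hT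
  have hΔ := Delta_pos hα hδ hδ'
  -- The relative loss: `R` is admissible for `ε` exactly when `D R = ε`.
  let D : ℝ → ℝ := fun R => 1 - clusterCoverage P α σ T X h δ R / idealCoverage P α σ T X h
  have hset : ∀ ε, admissibleRadii P α σ T X h δ ε = {R | 0 < R ∧ D R = ε} := by
    intro ε
    ext R
    refine and_congr_right fun _ => ?_
    simp only [D]
    rw [sub_eq_iff_eq_add, ← sub_eq_iff_eq_add', eq_comm (a := 1 - ε), div_eq_iff hE.ne']
  have heta : lam * T * Delta α δ * eta P α σ T X = lam * T * Delta α δ *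
      (∫ ω, Real.exp (-T * σ ^ 2 * nearestDist X ω ^ α) * nearestDist X ω ^ α ∂P) /
        idealCoverage P α σ T X h := by
    rw [eta, hideal, mul_div_assoc]
  have hc : 0 < lam * T * Delta α δ * eta P α σ T X := by
    rw [heta]
    positivity
  have hlim : Tendsto (fun R => R ^ (α - 2) * D R) atTop
      (𝓝 (lam * T * Delta α δ * eta P α σ T X)) := by
    rw [heta]
    refine ((tendsto_rpow_mul_coverage_loss hX hlam hh hlaw hind hXh σ hα hT hδ hδ').div_const
      (idealCoverage P α σ T X h)).congr fun R => ?_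
    simp only [D]
    field_simp
  have hmain := isLeast_and_isEquivalent_sInf_of_tendsto_rpow_mul (D := D)
    (show 0 < α - 2 by linarith) hc
    (fun R R' _ hRR' => sub_le_sub_left (div_le_div_of_nonneg_right
      (clusterCoverage_mono hX hh hlaw hind hXh σ hα hT hδ hδ' hRR') hE.le) _)
    (continuousOn_const.sub
      ((continuousOn_clusterCoverage hX hlam hh hlaw hind hXh σ hα hT hδ hδ').div_const _)) hlim
  simp only [optRadius, hset]
  exact hmain

omit [IsProbabilityMeasure P] in
lemma optRadius_nonneg {α σ T δ ε : ℝ} : 0 ≤ optRadius P α σ T X h δ ε :=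
  Real.sInf_nonneg fun _ hR => hR.1.le

lemma eta_of_noiseless (hX : IsPoissonProcess P lam X) (hlam : 0 < lam) {α σ T : ℝ}
    (hα : 0 < α) (hσ : σ ^ 2 = 0) :
    eta P α σ T X = Real.pi ^ (-α / 2) * lam ^ (-α / 2) * Real.Gamma (α / 2 + 1) := by
  rw [eta, hσ]
  simp only [mul_zero, zero_mul, Real.exp_zero, one_mul, integral_const, probReal_univ,
    smul_eq_mul, mul_one, div_one]
  exact hX.integral_nearestDist_rpow hlam hα

end Coverage

end

end CloudRadio

end

/-! ### The scaling law and its noiseless form. -/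

theorem lemma2 {Ω : Type*} [MeasurableSpace Ω] (P : Measure Ω) [IsProbabilityMeasure P]
    (lam α σ T δ : ℝ) (hlam : 0 < lam) (hα : 2 < α) (hT : 0 < T) (hδ : 0 < δ) (hδ' : δ ≤ 1)
    (X : ℕ → Ω → CloudRadio.Plane) (h : ℕ → Ω → ℂ)
    -- the base stations form a Poisson process of density `lam`
    (hX : CloudRadio.IsPoissonProcess P lam X)
    -- i.i.d. Rayleigh fading `CN(0,1)`, independent of the base stations
    (hh : ∀ n, Measurable (h n))
    (hhlaw : ∀ n, HasLaw (h n) CloudRadio.stdComplexGaussian P)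
    (hhindep : iIndepFun h P)
    (hXh : IndepFun (fun ω n => X n ω) (fun ω n => h n ω) P) :
    -- for small `ε` the smallest admissible radius exists
    (∀ᶠ ε in 𝓝[>] (0 : ℝ),
      IsLeast (CloudRadio.admissibleRadii P α σ T X h δ ε)
        (CloudRadio.optRadius P α σ T X h δ ε)) ∧
    -- its scaling
    (fun ε => CloudRadio.optRadius P α σ T X h δ ε) ~[𝓝[>] (0 : ℝ)]
      (fun ε => (lam * T * CloudRadio.Delta α δ * CloudRadio.eta P α σ T X * ε⁻¹) ^
        (1 / (α - 2))) ∧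
    -- the noiseless case
    (σ ^ 2 = 0 →
      CloudRadio.eta P α σ T X =
        Real.pi ^ (-α / 2) * lam ^ (-α / 2) * Real.Gamma (α / 2 + 1) ∧
      (∀ ε, CloudRadio.meanClusterSize P X (CloudRadio.optRadius P α σ T X h δ ε) =
        ENNReal.ofReal (lam * Real.pi * CloudRadio.optRadius P α σ T X h δ ε ^ 2)) ∧
      (fun ε => (CloudRadio.meanClusterSize P X
          (CloudRadio.optRadius P α σ T X h δ ε)).toReal) ~[𝓝[>] (0 : ℝ)]
        (fun ε => (T * CloudRadio.Delta α δ * Real.pi⁻¹ * Real.Gamma (α / 2 + 1) * ε⁻¹) ^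
          (2 / (α - 2)))) := by
  have hmain := CloudRadio.optRadius_isLeast_and_isEquivalent hX hlam hh hhlaw hhindep hXh σ hα hT
    hδ hδ'
  refine ⟨hmain.1, hmain.2, fun hσ => ?_⟩
  have heta := CloudRadio.eta_of_noiseless (T := T) hX hlam (show 0 < α by linarith) hσ
  have hmean : ∀ ε, CloudRadio.meanClusterSize P X (CloudRadio.optRadius P α σ T X h δ ε) =
      ENNReal.ofReal (lam * Real.pi * CloudRadio.optRadius P α σ T X h δ ε ^ 2) :=
    fun ε => hX.meanClusterSize_eq hlam CloudRadio.optRadius_nonneg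
  refine ⟨heta, hmean, ?_⟩
  have hΔ := CloudRadio.Delta_pos hα hδ hδ'
  have hΓ := Real.Gamma_pos_of_pos (show 0 < α / 2 + 1 by linarith)
  have hπ := Real.pi_pos
  have hb : 0 < lam * Real.pi := mul_pos hlam hπ
  have h1 := (hmain.2.pow 2).mul (IsEquivalent.refl (u := fun _ : ℝ => lam * Real.pi)
    (l := 𝓝[>] (0 : ℝ)))
  refine (h1.congr_left (.of_forall fun ε => ?_)).congr_right ?_
  · simp only [hmean]
    have := CloudRadio.optRadius_nonneg (P := P) (α := α) (σ := σ) (T := T) (X := X) (h := h)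
      (δ := δ) (ε := ε)
    rw [ENNReal.toReal_ofReal (by positivity), Pi.mul_apply, Pi.pow_apply, mul_comm]
  · filter_upwards [self_mem_nhdsWithin] with ε hε
    have hε' : (0 : ℝ) < ε := hε
    simp only [Pi.mul_apply, Pi.pow_apply]
    have hα2 : α - 2 ≠ 0 := by linarith
    -- Writing `λπ` as a power `2/(α - 2)` moves it inside the bracket, where `λ (λπ)^(-α/2)
    -- (λπ)^(α/2 - 1) = π⁻¹` removes the density.
    have h2 : lam * Real.pi = ((lam * Real.pi) ^ (α / 2 - 1)) ^ (2 / (α - 2)) := by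
      rw [← Real.rpow_mul hb.le, show (α / 2 - 1) * (2 / (α - 2)) = 1 by field_simp,
        Real.rpow_one]
    rw [heta, ← Real.rpow_natCast, ← Real.rpow_mul (by positivity)]
    nth_rewrite 1 [h2]
    rw [show 1 / (α - 2) * ((2 : ℕ) : ℝ) = 2 / (α - 2) by push_cast; ring,
      ← Real.mul_rpow (by positivity) (by positivity)]
    congr 1
    rw [show -α / 2 = -(α / 2) by ring, Real.rpow_neg hπ.le, Real.rpow_neg hlam.le,
      Real.rpow_sub hb, Real.rpow_one, Real.mul_rpow hlam.le hπ.le]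
    have := Real.rpow_pos_of_pos hπ (α / 2)
    have := Real.rpow_pos_of_pos hlam (α / 2)
    field_simp
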